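/- Let $R$ be a commutative unital ring, let $V$ and $W$ be $\mathbb Z$-graded $R$-modules, let $f:V\to W$ and $g:W\to V$ be linear maps of degree $0$, $h:V\to V$ a linear map of degree $1$, and let $\mu_n:V^{\otimes n}\to V$ ($n\ge 2$) be linear maps of degree $n-2$. (The case of interest: $V,W$ are chain complexes, $f,g$ are chain maps, $h$ is a chain homotopy between $gf$ and $\mathrm{id}_V$, and $(\mu_2,\mu_3,\dots)$ is an $A_\infty$-structure on $V$; none of these relations is needed.) Tensor products of maps obey the Koszul sign rule, and $\vartheta(u_1,\dots,u_s):=\sum_{1\le\alpha<\beta\le s}u_\alpha(u_\beta+1)$. **Kernels.** With the formal convention $h\circ p_1=\mathrm{id}$, put for $n\ge 2$ $$p_n:=\sum_{k\ge 2,\ r_1+\dots+r_k=n}(-1)^{\vartheta(r_1,\dots,r_k)}\mu_k(h p_{r_1}\otimes\dots\otimes h p_{r_k}),$$ and, for $1\le i\le n$, $$p^i_n:=\sum(-1)^{\vartheta(r_1,\dots,r_j)}\mu_k\bigl(h p_{r_1}\otimes\dots\otimes h p_{r_j}\otimes \mathrm{id}^{\otimes(n-i+1)}\bigr),$$ the sum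 being over all $j\ge 0$ and $r_1,\dots,r_j\ge 1$ with $r_1+\dots+r_j=i-1$ and $k=j+n-i+1\geq 2$. Put $q_1:=\mathrm{id}_V$ and, for $n\ge 2$, $$q_n:=\sum(-1)^{n+r_i+\vartheta(r_1,\dots,r_i)}\,p^i_k\bigl(gf q_{r_1}\otimes\dots\otimes gf q_{r_{i-1}}\otimes h q_{r_i}\otimes\mathrm{id}^{\otimes (k-i)}\bigr),\qquad(*)$$ the sum being over $2\le k\le n$, $1\le i\le k$, $r_1,\dots,r_i\ge1$ with $r_1+\dots+r_i+k-i=n$. **Decorated trees.** Consider planar rooted trees, drawn with the root at the top, all of whose vertices have at least two inputs. Order the vertices of such a tree totally as follows: a vertex is greater than every vertex below it (that is, every vertex whose path to the root passes through it), and if $v_a,v_b$ are vertices attached to the $a$-th and the $b$-th input of the same vertex, $a<b$, then $v_a$ and all vertices below $v_a$ are greater than $v_b$ and all vertices below $v_b$. Place the vertices on different levels, greater ones higher, and slightly below each vertex $v$ draw a horizontal line that starts at the leftmost input edge of $v$ and runs to the right across all edges that it meets there. Let $Q_n$ be the set of such trees with $n$ leaves together with a decoration of some of the edges by $\circ$ or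 $\bullet$, placed at intersections of edges with horizontal lines, such that: (i) if $x_1,\dots,x_k$ are the intersection points on a line, from left to right, then for some $0\le s\le k-1$ the points $x_1,\dots,x_s$ are decorated by $\bullet$, $x_{s+1}$ by $\circ$, and $x_{s+2},\dots,x_k$ are not decorated; (ii) each edge is decorated at most once; (iii) each interior edge is decorated. For $S\in Q_n$ let $G_S:V^{\otimes n}\to V$ be the nested composition described by $S$, where a vertex with $k$ inputs stands for $\mu_k$, $\circ$ for $h$, and $\bullet$ for $gf$. **Sign.** For a planar tree $T$ let $\vartheta(T)$ be the sum over its vertices $v$ of $\vartheta(s_1,\dots,s_k)$, where $s_b$ is the number of leaves of $T$ whose path to the root passes through the $b$-th input of $v$; and let $F_T$ be the composition described by $T$, with $\mu_k$ at the vertices of arity $k$ and $h$ on all interior edges. Let $S\in Q_n$, $n\ge 2$. Following $(*)$, let $T$ consist of the root of $S$ together with all vertices that can be reached along edges decorated by $\circ$ that start from an input of the root strictly to the left of the rightmost decorated input of the root. Let $S_1,\dots,S_i$, with $r_1,\dots,r_i$ leaves, be the subtrees of $S$ attached, from left to right, to those leaves of $T$ that are decorated edges of $S$ (the last one, $S_i$,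 at the rightmost decorated input of the root; any of them may be a single leaf). Let $\kappa\in\{0,1\}$ be the exponent of the Koszul sign between $F_T\circ(A_1\otimes\dots\otimes A_i\otimes\mathrm{id}\otimes\dots\otimes\mathrm{id})$ and the nested composition in which $A_\alpha$ is attached to the $\alpha$-th leaf of $T$, where $A_\alpha$ has degree $r_\alpha-1$ for $\alpha<i$ and $A_i$ has degree $r_i$. Decompose $S_1,\dots,S_i$ in the same way, until only leaves remain; this decomposes $S$ into p-kernel trees $T_1,\dots,T_m$. Let $$\varepsilon(S):=\sum_{T}\bigl(n_T+r_i+\vartheta(r_1,\dots,r_i)+\vartheta(T)+\kappa\bigr),$$ the sum being over $T\in\{T_1,\dots,T_m\}$, where $n_T$ is the number of leaves of the subtree of $S$ at the root of $T$, and $r_1,\dots,r_i$ and $\kappa$ belong to $T$. **Claim.** $q_1=\mathrm{id}_V$ and, for every $n\ge 2$, the set $Q_n$ is finite and $$q_n=\sum_{S\in Q_n}(-1)^{\varepsilon(S)}\,G_S .$$ -/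

import Mathlib

open scoped BigOperators

noncomputable section

namespace CarpKernel

/-! ### Multilinear operations on a graded module and the Koszul sign rule -/

/-- `n`-ary operations, that is, linear maps from the `n`-th tensor power of `V` to `V`. -/
abbrev Op (R V : Type*) [CommRing R] [AddCommGroup V] [Module R V] (n : ℕ) : Type _ :=
  MultilinearMap R (fun _ : Fin n => V) V

section Operations

variable {R V : Type*} [CommRing R] [AddCommGroup V] [Module R V]

/-- The identity map of `V` as a unary operation. -/
def idOp : Op R V 1 := MultilinearMap.ofSubsingleton R V V (0 : Fin 1) LinearMap.id

/-- Transport of an operation along an equality of arities. -/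
def castOp {m n : ℕ} (hmn : m = n) (φ : Op R V m) : Op R V n :=
  φ.domDomCongr (finCongr hmn)

variable (𝒱 : ℤ → Submodule R V) [DirectSum.Decomposition 𝒱]

/-- The linear map `x ↦ (-1) ^ (e * |x|) x` (for homogeneous `x`): the Koszul sign created when
an operator of degree `e` moves past `x`. -/
def koszulTwist (e : ℤ) : V →ₗ[R] V :=
  (DirectSum.toModule R ℤ V fun i => (e * i).negOnePow • (𝒱 i).subtype) ∘ₗ
    (DirectSum.decomposeLinearEquiv 𝒱).toLinearMap

/-- The composition `φ ∘ (ψ₁ ⊗ ⋯ ⊗ ψₖ)` of graded maps, where `ψ_b` has `r b` inputs and degree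
`d b`. By the Koszul rule, each argument of `ψ_b` is passed by `ψ_c` for all `c > b`. -/
def blockComp {k : ℕ} {r : Fin k → ℕ} (φ : Op R V k) (d : Fin k → ℤ)
    (ψ : ∀ b, Op R V (r b)) : Op R V (∑ b, r b) :=
  (φ.compMultilinearMap fun b =>
    (ψ b).compLinearMap fun _ => koszulTwist 𝒱 (∑ c ∈ Finset.Ioi b, d c)).domDomCongr
      finSigmaFinEquiv

end Operations

/-! ### The inductively defined kernels -/

/-- `ϑ(u₁, …, u_s) = ∑_{α < β} u_α (u_β + 1)`. -/
def theta : List ℕ → ℕ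
  | [] => 0
  | u :: us => (us.map fun w => u * (w + 1)).sum + theta us

theorem blocksFun_lt {n : ℕ} (c : Composition n) (hc : 2 ≤ c.length) (b : Fin c.length) :
    c.blocksFun b < n := by
  have hn : 0 < n := c.length_pos_iff.1 (by omega)
  refine (Composition.ne_single_iff hn).1 ?_ b
  rintro rfl
  simp at hc

section Kernels

variable {R V : Type*} [CommRing R] [AddCommGroup V] [Module R V]

/-- `h ∘ p_r`, with the formal convention that `h ∘ p_1` is the identity. -/
def withH (h : V →ₗ[R] V) : (r : ℕ) → Op R V r → Op R V r
  | 1, _ => idOp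
  | _, φ => h.compMultilinearMap φ

variable (𝒱 : ℤ → Submodule R V) [DirectSum.Decomposition 𝒱]
variable (μ : ∀ n, Op R V n) (h e : V →ₗ[R] V)

/-- The p-kernel: the sum of `(-1) ^ ϑ(r₁, …, r_k) μ_k (h p_{r₁} ⊗ ⋯ ⊗ h p_{r_k})` over all
`k ≥ 2` and `r₁ + ⋯ + r_k = n`. For `n = 2` this is `μ_2`; the values at `n ≤ 1` are never used.
The map `h p_r` has degree `r - 1`. -/
def pKernel (n : ℕ) : Op R V n :=
  ∑ c : {c : Composition n // 2 ≤ c.length},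
    (theta c.1.blocks : ℤ).negOnePow •
      castOp c.1.sum_blocksFun
        (blockComp 𝒱 (μ c.1.length) (fun b => (c.1.blocksFun b : ℤ) - 1)
          fun b => withH h _ (pKernel (c.1.blocksFun b)))
termination_by n
decreasing_by exact blocksFun_lt c.1 c.2 b

/-- The part `p^i_n` of `p_n` in which the `i`-th input and all inputs to the right of it are
inputs of the outermost operation: the sum of
`(-1) ^ ϑ(r₁, …, r_j) μ_k (h p_{r₁} ⊗ ⋯ ⊗ h p_{r_j} ⊗ id ^ (n - i + 1))` over all `k ≥ 2` and
`r₁ + ⋯ + r_j = i - 1` with `k = j + n - i + 1`. The summands are indexed by the compositions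
`(r₁, …, r_j, 1, …, 1)` of `n`. The positions are counted from zero, so that `i : Fin n` is
the position `i + 1` of the usual count, and `c.index i` is the number `j`. -/
def pKernelAt (n : ℕ) (i : Fin n) : Op R V n :=
  ∑ c : {c : Composition n // 2 ≤ c.length ∧ ∀ m, i ≤ m → c.blocksFun (c.index m) = 1},
    (theta (c.1.blocks.take (c.1.index i)) : ℤ).negOnePow •
      castOp c.1.sum_blocksFun
        (blockComp 𝒱 (μ c.1.length) (fun b => (c.1.blocksFun b : ℤ) - 1)
          fun b => withH h _ (pKernel 𝒱 μ h (c.1.blocksFun b)))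

/-- The q-kernel, where `e` stands for `g ∘ f`: `q_1 = id` and, for `n ≥ 2`, `q_n` is the sum of
`(-1) ^ (n + r_i + ϑ(r₁, …, r_i))
  p^i_k (e q_{r₁} ⊗ ⋯ ⊗ e q_{r_{i-1}} ⊗ h q_{r_i} ⊗ id ^ (k - i))`
over all `2 ≤ k`, `1 ≤ i ≤ k` and `r₁ + ⋯ + r_i + k - i = n`. The summands are indexed by the
compositions `(r₁, …, r_i, 1, …, 1)` of `n` with `k` parts together with the position of `r_i`
(counted from zero); a factor `id` is written as `q_1`. The degree of `e q_r` is `r - 1` and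
that of `h q_r` is `r`. The value at `n = 0` is never used. -/
def qKernel : (n : ℕ) → Op R V n
  | 0 => 0
  | 1 => idOp
  | n + 2 =>
    ∑ c : {c : Composition (n + 2) // 2 ≤ c.length},
      ∑ i : {i : Fin c.1.length // ∀ b, i < b → c.1.blocksFun b = 1},
        ((n + 2 : ℤ) + c.1.blocksFun i.1 + theta (c.1.blocks.take (i.1 + 1))).negOnePow •
          castOp c.1.sum_blocksFun
            (blockComp 𝒱 (pKernelAt 𝒱 μ h c.1.length i.1)
              (fun b => if b = i.1 then (c.1.blocksFun b : ℤ) else c.1.blocksFun b - 1)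
              fun b =>
                (if b < i.1 then e else if b = i.1 then h else LinearMap.id).compMultilinearMap
                  (qKernel (c.1.blocksFun b)))
termination_by n => n
decreasing_by exact blocksFun_lt c.1 c.2 b

end Kernels

/-! ### Planar trees -/

/-- Planar rooted trees all of whose vertices have at least two inputs. -/
inductive PTree : Type
  | leaf : PTree
  | node (k : ℕ) (hk : 2 ≤ k) (child : Fin k → PTree) : PTree

namespace PTree

/-- The number of leaves. -/
def leaves : PTree → ℕ
  | leaf => 1
  | node _ _ child => ∑ b, (child b).leaves

/-- `ϑ(T)`: the sum over all vertices of `ϑ(r₁, …, r_k)`, where `r_b` is the number of leaves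
of `T` whose path to the root runs through the `b`-th input of the vertex. -/
def vartheta : PTree → ℕ
  | leaf => 0
  | node _ _ child => theta (List.ofFn fun b => (child b).leaves) + ∑ b, (child b).vartheta

/-- The exponent of the Koszul sign between the composition `F_T ∘ (A₁ ⊗ ⋯ ⊗ A_s)`, where `A_α`
has degree `d α`, and the flow chart in which `A_α` is attached to the `α`-th leaf of `T`. Here
each interior edge of `T` carries `h`, so that the subtree with `s` leaves attached to an input of
a vertex stands for a map of degree `s - 1` (for a leaf this is the identity, of degree zero);
it moves past the maps attached to the leaves of the preceding subtrees at the same vertex. -/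
def koszul : (T : PTree) → (Fin T.leaves → ℤ) → ℤ
  | leaf, _ => 0
  | node _ _ child, d =>
    (∑ c, ∑ b ∈ Finset.Iio c,
      (((child c).leaves : ℤ) - 1) * ∑ α, d (finSigmaFinEquiv ⟨b, α⟩)) +
    ∑ b, (child b).koszul fun α => d (finSigmaFinEquiv ⟨b, α⟩)

end PTree

/-- The two decorations: `circle` stands for the homotopy `h`, and `dot` for `g ∘ f`. -/
inductive Mark : Type
  | circle : Mark
  | dot : Mark
  deriving DecidableEq

/-- Planar rooted trees with at least binary vertices in which every edge except for the root
edge may carry a decoration; `mark b` is the decoration of the `b`-th input edge of a vertex. -/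
inductive DecTree : Type
  | leaf : DecTree
  | node (k : ℕ) (hk : 2 ≤ k) (mark : Fin k → Option Mark) (child : Fin k → DecTree) : DecTree

namespace DecTree

/-- The number of leaves. -/
def leaves : DecTree → ℕ
  | leaf => 1
  | node _ _ _ child => ∑ b, (child b).leaves

/-! #### Levels, horizontal lines and the carp rules

A vertex or leaf of a tree is addressed by the list of (zero-based) input numbers that leads to
it from the root, and an edge other than the root edge by the address `e` of its end farther from
the root (so its end nearer to the root is the vertex `e.dropLast`). The root is drawn at the top. -/

/-- The subtree at an address, if there is one. -/
def subtree? : DecTree → List ℕ → Option DecTree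
  | S, [] => some S
  | leaf, _ :: _ => none
  | node k _ _ child, i :: a => if hi : i < k then (child ⟨i, hi⟩).subtree? a else none

/-- The decoration of the edge at an address. -/
def markAt : DecTree → List ℕ → Option Mark
  | node k _ mark _, [i] => if hi : i < k then mark ⟨i, hi⟩ else none
  | node k _ _ child, i :: j :: a =>
    if hi : i < k then (child ⟨i, hi⟩).markAt (j :: a) else none
  | _, _ => none

/-- The address `v` is that of a vertex. -/
def IsVertex (S : DecTree) (v : List ℕ) : Prop :=
  ∃ k hk mark child, S.subtree? v = some (node k hk mark child)

/-- The address `e` is that of an edge (interior or leaf) other than the root edge. -/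
def IsEdge (S : DecTree) (e : List ℕ) : Prop :=
  e ≠ [] ∧ (S.subtree? e).isSome

/-- The canonical total order on vertices: `u` is less than `v` if and only if `v` precedes `u`
lexicographically (where a list precedes its proper extensions). -/
def VertexLT (u v : List ℕ) : Prop := v < u

/-- Every vertex is greater than the vertices for which it lies on the path to the root. -/
theorem vertexLT_append (v w : List ℕ) (hw : w ≠ []) : VertexLT (v ++ w) v := by
  induction v with
  | nil => cases w with
    | nil => exact absurd rfl hw
    | cons a w => exact List.Lex.nil
  | cons a v ih => exact List.Lex.cons ih

/-- A vertex and everything that branches off from it are greater than everything that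
branches off from an input of the same parent further to the right. -/
theorem vertexLT_of_input_lt (v s t : List ℕ) {i j : ℕ} (hij : i < j) :
    VertexLT (v ++ j :: t) (v ++ i :: s) := by
  induction v with
  | nil => exact List.Lex.rel hij
  | cons a v ih => exact List.Lex.cons ih

/-- The horizontal line drawn slightly below the level of the vertex `v`, when each vertex has
its own level and greater vertices are higher, and the line runs from the leftmost input edge of
`v` to the right, crosses the edge `e`: the top vertex of `e` is `v` or a higher vertex, and the
other end of `e` (a leaf or a lower vertex) comes after `v`. The crossing points are ordered from
left to right by the lexicographic order of the addresses `e`. -/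
def Crosses (S : DecTree) (v e : List ℕ) : Prop :=
  S.IsVertex v ∧ S.IsEdge e ∧ (e.dropLast = v ∨ VertexLT v e.dropLast) ∧ v < e

/-- The carp rules. The decorations of the edges can be placed at crossings with horizontal
lines, `line e` being the vertex that owns the line on which the decoration of `e` sits, such
that on every line there is a crossing point `e₀` that is decorated by a circle, all crossing
points to the left of `e₀` are decorated by dots, and none to the right of `e₀` is decorated (on
this line). Every edge is decorated at most once by construction, and every interior edge is
required to be decorated. -/
def IsCarp (S : DecTree) : Prop :=
  (∃ line : List ℕ → List ℕ,
    (∀ e, S.IsEdge e → S.markAt e ≠ none → S.Crosses (line e) e) ∧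
    ∀ v, S.IsVertex v → ∃ e₀, S.Crosses v e₀ ∧
      (S.markAt e₀ = some Mark.circle ∧ line e₀ = v) ∧
      (∀ e, S.Crosses v e → e < e₀ → S.markAt e = some Mark.dot ∧ line e = v) ∧
      (∀ e, S.Crosses v e → e₀ < e → ¬ (S.markAt e ≠ none ∧ line e = v))) ∧
  ∀ e, S.IsEdge e → S.IsVertex e → S.markAt e ≠ none

/-! #### The flow chart of a decorated tree -/

/-- The degree of a decoration: `h` has degree one and `g ∘ f` has degree zero. -/
def markDegree : Option Mark → ℤ
  | some Mark.circle => 1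
  | _ => 0

/-- The degree of the map described by a decorated tree; a vertex of arity `k` has degree
`k - 2`. -/
def degree : DecTree → ℤ
  | leaf => 0
  | node k _ mark child => (k : ℤ) - 2 + ∑ b, (markDegree (mark b) + (child b).degree)

section Flow

variable {R V : Type*} [CommRing R] [AddCommGroup V] [Module R V]
variable (𝒱 : ℤ → Submodule R V) [DirectSum.Decomposition 𝒱]
variable (μ : ∀ n, Op R V n) (h e : V →ₗ[R] V)

/-- The map denoted by a decoration. -/
def markMap : Option Mark → V →ₗ[R] V
  | some Mark.circle => h
  | some Mark.dot => e
  | none => LinearMap.id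

/-- The map `G_S`: a vertex of arity `k` stands for `μ_k`, a circle for `h`, and a dot for
`e = g ∘ f`. -/
def flow : (S : DecTree) → Op R V S.leaves
  | leaf => idOp
  | node k _ mark child =>
    blockComp 𝒱 (μ k) (fun b => markDegree (mark b) + (child b).degree)
      fun b => (markMap h e (mark b)).compMultilinearMap ((child b).flow)

end Flow

/-! #### Decomposition into p-kernel trees and the sign

The tree `S` is decomposed along the pattern
`p^i_k (gf q_{r₁} ⊗ ⋯ ⊗ gf q_{r_{i-1}} ⊗ h q_{r_i} ⊗ id ^ (k - i))` of the q-kernel: the rightmost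
decorated input edge of the root is the edge `h q_{r_i}`; everything to the right of it is
undecorated. The summand `T` of `p^i_k` consists of the root together with all vertices that can
be reached through inputs of the root to the left of that edge along edges decorated by circles.
The subtrees that are cut off are decomposed in the same way. -/

/-- The `b`-th input lies strictly to the left of the rightmost decorated input. -/
def IsLeft {k : ℕ} (mark : Fin k → Option Mark) (b : Fin k) : Prop :=
  ∃ c, b < c ∧ mark c ≠ none

instance {k : ℕ} (mark : Fin k → Option Mark) (b : Fin k) : Decidable (IsLeft mark b) :=
  inferInstanceAs (Decidable (∃ c, b < c ∧ mark c ≠ none))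

/-- The part of a tree that is reached from its root along edges decorated by circles. -/
def circlePiece : DecTree → PTree
  | leaf => PTree.leaf
  | node k hk mark child => PTree.node k hk fun b =>
      if mark b = some Mark.circle then (child b).circlePiece else PTree.leaf

/-- The subtrees that sit at the leaves of `circlePiece`, from left to right. -/
def circleParts : DecTree → List DecTree
  | leaf => [leaf]
  | node k _ mark child => (List.finRange k).flatMap fun b =>
      if mark b = some Mark.circle then (child b).circleParts else [child b]

/-- The p-kernel tree `T` at the root of `S`. -/
def topPiece : DecTree → PTree
  | leaf => PTree.leaf
  | node k hk mark child => PTree.node k hk fun b =>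
      if IsLeft mark b ∧ mark b = some Mark.circle then (child b).circlePiece else PTree.leaf

/-- The subtrees `S₁, …, S_i` that sit at the first `i` leaves of `topPiece`. -/
def topParts : DecTree → List DecTree
  | leaf => []
  | node k _ mark child => (List.finRange k).flatMap fun b =>
      if IsLeft mark b then
        if mark b = some Mark.circle then (child b).circleParts else [child b]
      else if mark b ≠ none then [child b] else []

/-- The numbers `r₁, …, r_i`. -/
def sizes (S : DecTree) : List ℕ := S.topParts.map leaves

/-- The degree of the map that is plugged into the `α`-th input (counted from zero) of `p^i_k`:
`gf q_{r_α}` has degree `r_α - 1`, `h q_{r_i}` has degree `r_i`, and `id` has degree zero. -/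
def pluggedDegree (r : List ℕ) (α : ℕ) : ℤ :=
  if α + 1 < r.length then (r.getD α 0 : ℤ) - 1
  else if α + 1 = r.length then (r.getD α 0 : ℤ) else 0

/-- The contribution of the p-kernel tree `T` at the root of `S`, a tree with `n` leaves:
`n + r_i + ϑ(r₁, …, r_i) + ϑ(T)`, plus the Koszul sign of the composition
`F_T ∘ (gf q_{r₁} ⊗ ⋯ ⊗ gf q_{r_{i-1}} ⊗ h q_{r_i} ⊗ id ^ (k - i))`. -/
def localSign (S : DecTree) : ℤ :=
  S.leaves + (S.sizes.getLastD 0 : ℤ) + theta S.sizes + S.topPiece.vartheta +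
    S.topPiece.koszul fun α => pluggedDegree S.sizes α

/-- The sum of the contributions of all p-kernel trees in the decomposition of a tree. The flag
tells whether the root of the tree is the root of one of these p-kernel trees (`true`), or
belongs to a p-kernel tree that was started nearer to the root (`false`). -/
def signAux : Bool → DecTree → ℤ
  | _, leaf => 0
  | true, node k hk mark child =>
      (node k hk mark child).localSign +
        ∑ b, signAux (!decide (IsLeft mark b ∧ mark b = some Mark.circle)) (child b)
  | false, node _ _ mark child =>
      ∑ b, signAux (!decide (mark b = some Mark.circle)) (child b)

/-- The exponent `ε(S)`. -/
def eps (S : DecTree) : ℤ := signAux true S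

end DecTree

/-- The set `Q_n` of decorated trees with `n` leaves. -/
def carpTrees (n : ℕ) : Set DecTree := {S | S.leaves = n ∧ S.IsCarp}

end CarpKernel

end

noncomputable section

namespace CarpKernel

/-! ### Blocks of consecutive natural numbers -/

/-- The number of inputs in the blocks before the `b`-th one, when block `c` has `L c` inputs. -/
def blockStart {k : ℕ} (L : Fin k → ℕ) (b : Fin k) : ℕ := ∑ c ∈ Finset.Iio b, L c

theorem finSigmaFinEquiv_val {k : ℕ} (L : Fin k → ℕ) (b : Fin k) (j : Fin (L b)) :
    (finSigmaFinEquiv ⟨b, j⟩ : ℕ) = blockStart L b + j := by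
  rw [finSigmaFinEquiv_apply, blockStart]
  congr 1
  refine Finset.sum_nbij (fun i => Fin.castLE b.2.le i) ?_ ?_ ?_ ?_
  · intro i _
    simp [Fin.lt_def]
  · intro i _ j _ hij
    simpa using hij
  · intro c hc
    have hc : c < b := by simpa using hc
    exact ⟨⟨c, hc⟩, by simp, rfl⟩
  · intro i _
    rfl

@[to_additive]
theorem prod_blocks {M : Type*} [CommMonoid M] {k : ℕ} (L : Fin k → ℕ) (s : ℕ → M) :
    ∏ b, ∏ j ∈ Finset.range (L b), s (blockStart L b + j) = ∏ j ∈ Finset.range (∑ b, L b), s j := by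
  rw [← Fin.prod_univ_eq_prod_range, ← finSigmaFinEquiv.prod_comp, Fintype.prod_sigma]
  refine Finset.prod_congr rfl fun b _ => ?_
  rw [← Fin.prod_univ_eq_prod_range (fun j => s (blockStart L b + j))]
  refine Finset.prod_congr rfl fun j _ => ?_
  rw [finSigmaFinEquiv_val]

theorem blockStart_mono {k : ℕ} (L : Fin k → ℕ) {b c : Fin k} (hbc : b < c) :
    blockStart L b + L b ≤ blockStart L c := by
  have : blockStart L b + L b = ∑ a ∈ Finset.Iic b, L a := by
    rw [blockStart, add_comm, ← Finset.Iio_insert, Finset.sum_insert (by simp)]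
  rw [this]
  refine Finset.sum_le_sum_of_subset fun a ha => ?_
  simp only [Finset.mem_Iic, Finset.mem_Iio] at *
  exact lt_of_le_of_lt ha hbc

theorem blockStart_add_le {k : ℕ} (L : Fin k → ℕ) (b : Fin k) :
    blockStart L b + L b ≤ ∑ c, L c := by
  have : blockStart L b + L b = ∑ a ∈ Finset.Iic b, L a := by
    rw [blockStart, add_comm, ← Finset.Iio_insert, Finset.sum_insert (by simp)]
  rw [this]
  exact Finset.sum_le_sum_of_subset (Finset.subset_univ _)

theorem exists_block {k : ℕ} (L : Fin k → ℕ) {m : ℕ} (hm : m < ∑ b, L b) :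
    ∃ b, ∃ j < L b, m = blockStart L b + j := by
  obtain ⟨⟨b, j⟩, hj⟩ := finSigmaFinEquiv.surjective (⟨m, hm⟩ : Fin (∑ b, L b))
  exact ⟨b, j, j.2, by rw [← finSigmaFinEquiv_val, hj]⟩

theorem block_unique {k : ℕ} (L : Fin k → ℕ) {b c : Fin k} {i j : ℕ} (hi : i < L b)
    (hj : j < L c) (h : blockStart L b + i = blockStart L c + j) : b = c ∧ i = j := by
  rcases lt_trichotomy b c with hbc | rfl | hbc
  · have := blockStart_mono L hbc
    omega
  · exact ⟨rfl, by omega⟩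
  · have := blockStart_mono L hbc
    omega

/-- Summing over the blocks of blocks. -/
theorem sum_range_blockStart {k : ℕ} (L : Fin k → ℕ) (r : ℕ → ℕ) (b : Fin k) :
    blockStart (fun c => ∑ j ∈ Finset.range (L c), r (blockStart L c + j)) b =
      ∑ j ∈ Finset.range (blockStart L b), r j := by
  have hb : blockStart L b = ∑ c, if c < b then L c else 0 := by
    rw [blockStart, ← Finset.sum_filter]
    congr 1
    ext; simp
  conv_rhs => rw [hb, ← sum_blocks]
  rw [blockStart, ← Finset.sum_subset (Finset.subset_univ (Finset.Iio b))]
  · refine Finset.sum_congr rfl fun c hc => ?_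
    have hc : c < b := by simpa using hc
    rw [if_pos hc]
    have : blockStart (fun c => if c < b then L c else 0) c = blockStart L c := by
      refine Finset.sum_congr rfl fun a ha => ?_
      have ha : a < c := by simpa using ha
      exact if_pos (ha.trans hc)
    rw [this]
  · intro c _ hc
    have hc : ¬ c < b := by simpa using hc
    simp [hc]

theorem sum_Ioo_block {k : ℕ} (L : Fin k → ℕ) (d : ℕ → ℤ) (b : Fin k) {j : ℕ} (hj : j < L b) :
    ∑ α ∈ Finset.Ioo (blockStart L b + j) (∑ c, L c), d α =
      ∑ α ∈ Finset.Ioo j (L b), d (blockStart L b + α) +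
        ∑ c ∈ Finset.Ioi b, ∑ α ∈ Finset.range (L c), d (blockStart L c + α) := by
  have key : ∀ n m : ℕ, ∀ f : ℕ → ℤ, ∑ α ∈ Finset.Ioo m n, f α =
      ∑ α ∈ Finset.range n, if m < α then f α else 0 := by
    intro n m f
    rw [← Finset.sum_filter]
    congr 1
    ext; simp [and_comm]
  rw [key, key, ← sum_blocks, ← Finset.add_sum_erase _ _ (Finset.mem_univ b)]
  congr 1
  · refine Finset.sum_congr rfl fun α _ => ?_
    simp
  · refine (Finset.sum_subset_zero_on_sdiff ?_ ?_ ?_).symm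
    · intro c hc
      have hc : b < c := by simpa using hc
      simp [hc.ne']
    · intro c hc
      have hc : c < b := by
        simp only [Finset.mem_sdiff, Finset.mem_erase, Finset.mem_univ, and_true,
          Finset.mem_Ioi, not_lt] at hc
        exact lt_of_le_of_ne hc.2 hc.1
      refine Finset.sum_eq_zero fun α hα => if_neg ?_
      have := blockStart_mono L hc
      simp only [Finset.mem_range] at hα
      omega
    · intro c hc
      have hc : b < c := by simpa using hc
      refine Finset.sum_congr rfl fun α hα => (if_pos ?_).symm
      have := blockStart_mono L hc
      omega

/-- A family of sequences can be glued to one sequence along blocks. -/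
theorem exists_glue {X : Type*} {k : ℕ} (L : Fin k → ℕ) (f : Fin k → ℕ → X) (P : X → Prop) (x₀ : X)
    (hx₀ : P x₀) (hf : ∀ b j, P (f b j)) :
    ∃ F : ℕ → X, (∀ b, ∀ j < L b, F (blockStart L b + j) = f b j) ∧ ∀ j, P (F j) := by
  classical
  refine ⟨fun m => if hm : m < ∑ b, L b then
    f (exists_block L hm).choose (exists_block L hm).choose_spec.choose else x₀, ?_, ?_⟩
  · intro b j hj
    have hm : blockStart L b + j < ∑ b, L b := by
      have := blockStart_add_le L b
      omega
    have h1 := (exists_block L hm).choose_spec.choose_spec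
    have h2 := block_unique L hj h1.1 h1.2
    simp only [dif_pos hm]
    exact congrArg₂ f h2.1.symm h2.2.symm
  · intro j
    by_cases hm : j < ∑ b, L b
    · simpa only [dif_pos hm] using hf _ _
    · simpa only [dif_neg hm] using hx₀

/-! ### Signs and the Koszul twist -/

/-- The sign `(-1) ^ n` as an element of `R`. -/
def sgn (R : Type*) [CommRing R] (n : ℤ) : R := ((n.negOnePow : ℤ) : R)

section Signs

variable (R : Type*) {V : Type*} [CommRing R] [AddCommGroup V] [Module R V]

theorem negOnePow_smul_eq (n : ℤ) (v : V) : n.negOnePow • v = sgn R n • v := by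
  rw [sgn, Int.cast_smul_eq_zsmul, Units.smul_def]

theorem sgn_zero : sgn R 0 = 1 := by simp [sgn]

theorem sgn_add (m n : ℤ) : sgn R (m + n) = sgn R m * sgn R n := by
  simp [sgn, Int.negOnePow_add]

theorem sgn_sum {ι : Type*} (s : Finset ι) (f : ι → ℤ) :
    sgn R (∑ i ∈ s, f i) = ∏ i ∈ s, sgn R (f i) := by
  classical
  induction s using Finset.induction_on with
  | empty => simp [sgn_zero]
  | insert a s ha ih => rw [Finset.sum_insert ha, Finset.prod_insert ha, sgn_add, ih]

theorem sgn_congr {m n : ℤ} (hmn : Even (m - n)) : sgn R m = sgn R n := by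
  have : m = (m - n) + n := by ring
  rw [this, sgn_add, sgn, Int.negOnePow_even _ hmn]
  simp

end Signs

section Twist

variable {R V : Type*} [CommRing R] [AddCommGroup V] [Module R V]
variable (𝒱 : ℤ → Submodule R V) [DirectSum.Decomposition 𝒱]

theorem koszulTwist_of_mem (e : ℤ) {i : ℤ} {x : V} (hx : x ∈ 𝒱 i) :
    koszulTwist 𝒱 e x = sgn R (e * i) • x := by
  rw [← negOnePow_smul_eq]
  simp only [koszulTwist, LinearMap.comp_apply, LinearEquiv.coe_coe,
    DirectSum.decomposeLinearEquiv_apply]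
  rw [DirectSum.decompose_of_mem 𝒱 hx, ← DirectSum.lof_eq_of R, DirectSum.toModule_lof]
  rfl

theorem linearMap_ext_homogeneous {f g : V →ₗ[R] V} (hfg : ∀ i, ∀ x ∈ 𝒱 i, f x = g x) : f = g := by
  ext x
  induction x using DirectSum.Decomposition.inductionOn 𝒱 with
  | zero => simp
  | homogeneous x => exact hfg _ _ x.2
  | add x y hx hy => rw [map_add, map_add, hx, hy]

theorem op_ext_homogeneous {n : ℕ} {φ ψ : Op R V n}
    (hφ : ∀ (a : Fin n → ℤ) (x : Fin n → V), (∀ j, x j ∈ 𝒱 (a j)) → φ x = ψ x) : φ = ψ := by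
  classical
  ext x
  have hx : x = fun j => ∑ i ∈ (DirectSum.decompose 𝒱 (x j)).support,
      ((DirectSum.decompose 𝒱 (x j) i : 𝒱 i) : V) :=
    funext fun j => (DirectSum.sum_support_decompose 𝒱 (x j)).symm
  rw [hx, MultilinearMap.map_sum_finset, MultilinearMap.map_sum_finset]
  refine Finset.sum_congr rfl fun r _ => ?_
  exact hφ r _ fun j => (DirectSum.decompose 𝒱 (x j) (r j)).2

theorem koszulTwist_zero (x : V) : koszulTwist 𝒱 0 x = x := by
  have : koszulTwist 𝒱 0 = LinearMap.id := linearMap_ext_homogeneous 𝒱 fun i x hx => by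
    simp [koszulTwist_of_mem 𝒱 0 hx, sgn_zero]
  rw [this]; rfl

theorem koszulTwist_add (a b : ℤ) (x : V) :
    koszulTwist 𝒱 a (koszulTwist 𝒱 b x) = koszulTwist 𝒱 (a + b) x := by
  have : koszulTwist 𝒱 a ∘ₗ koszulTwist 𝒱 b = koszulTwist 𝒱 (a + b) :=
    linearMap_ext_homogeneous 𝒱 fun i x hx => by
      rw [LinearMap.comp_apply, koszulTwist_of_mem 𝒱 b hx, map_smul, koszulTwist_of_mem 𝒱 a hx,
        koszulTwist_of_mem 𝒱 _ hx, smul_smul, ← sgn_add]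
      congr 2; ring
  rw [← this]; rfl

theorem koszulTwist_comm (a b : ℤ) (x : V) :
    koszulTwist 𝒱 a (koszulTwist 𝒱 b x) = koszulTwist 𝒱 b (koszulTwist 𝒱 a x) := by
  rw [koszulTwist_add, koszulTwist_add, add_comm]

theorem koszulTwist_linearMap {D : ℤ} {f : V →ₗ[R] V} (hf : ∀ i, ∀ x ∈ 𝒱 i, f x ∈ 𝒱 (i + D))
    (e : ℤ) (x : V) : koszulTwist 𝒱 e (f x) = sgn R (e * D) • f (koszulTwist 𝒱 e x) := by
  have : koszulTwist 𝒱 e ∘ₗ f = sgn R (e * D) • (f ∘ₗ koszulTwist 𝒱 e) :=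
    linearMap_ext_homogeneous 𝒱 fun i x hx => by
      rw [LinearMap.smul_apply, LinearMap.comp_apply, LinearMap.comp_apply,
        koszulTwist_of_mem 𝒱 e hx, map_smul, koszulTwist_of_mem 𝒱 e (hf i x hx), smul_smul,
        ← sgn_add]
      congr 2; ring
  exact LinearMap.congr_fun this x

theorem koszulTwist_op {n : ℕ} {D : ℤ} {φ : Op R V n}
    (hφ : ∀ (a : Fin n → ℤ) (x : Fin n → V), (∀ j, x j ∈ 𝒱 (a j)) → φ x ∈ 𝒱 ((∑ j, a j) + D))
    (e : ℤ) (x : Fin n → V) :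
    koszulTwist 𝒱 e (φ x) = sgn R (e * D) • φ fun j => koszulTwist 𝒱 e (x j) := by
  have : (koszulTwist 𝒱 e).compMultilinearMap φ =
      sgn R (e * D) • φ.compLinearMap fun _ => koszulTwist 𝒱 e :=
    op_ext_homogeneous 𝒱 fun a x hx => by
      rw [smul_apply, LinearMap.compMultilinearMap_apply,
        MultilinearMap.compLinearMap_apply, koszulTwist_of_mem 𝒱 e (hφ a x hx)]
      have : (fun j => koszulTwist 𝒱 e (x j)) = fun j => sgn R (e * a j) • x j :=
        funext fun j => koszulTwist_of_mem 𝒱 e (hx j)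
      rw [this, MultilinearMap.map_smul_univ, smul_smul, ← sgn_sum, ← sgn_add]
      congr 2
      rw [mul_add, Finset.mul_sum, add_comm]
  have := congrArg (fun ψ : Op R V n => ψ x) this
  simpa using this

end Twist

/-! ### Evaluation of operations on sequences -/

section Eval

variable {R V : Type*} [CommRing R] [AddCommGroup V] [Module R V]

/-- The value of an operation at the first entries of a sequence. -/
def evalSeq {n : ℕ} (φ : Op R V n) (x : ℕ → V) : V := φ fun i => x i

theorem evalSeq_ext {n : ℕ} {φ ψ : Op R V n} (hφ : ∀ x, evalSeq φ x = evalSeq ψ x) : φ = ψ := by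
  ext x
  have := hφ fun m => if hm : m < n then x ⟨m, hm⟩ else 0
  simpa [evalSeq] using this

@[simp]
theorem evalSeq_castOp {m n : ℕ} (hmn : m = n) (φ : Op R V m) (x : ℕ → V) :
    evalSeq (castOp hmn φ) x = evalSeq φ x := by
  subst hmn
  rfl

theorem evalSeq_sum {n : ℕ} {ι : Type*} (s : Finset ι) (φ : ι → Op R V n) (x : ℕ → V) :
    evalSeq (∑ i ∈ s, φ i) x = ∑ i ∈ s, evalSeq (φ i) x := by
  simp [evalSeq]

theorem evalSeq_negOnePow_smul {n : ℕ} (m : ℤ) (φ : Op R V n) (x : ℕ → V) :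
    evalSeq (m.negOnePow • φ) x = sgn R m • evalSeq φ x := by
  rw [negOnePow_smul_eq R]
  rfl

@[simp]
theorem evalSeq_compMultilinearMap {n : ℕ} (f : V →ₗ[R] V) (φ : Op R V n) (x : ℕ → V) :
    evalSeq (f.compMultilinearMap φ) x = f (evalSeq φ x) := rfl

variable (𝒱 : ℤ → Submodule R V) [DirectSum.Decomposition 𝒱]

theorem evalSeq_blockComp {k : ℕ} {r : Fin k → ℕ} (φ : Op R V k) (d : Fin k → ℤ)
    (ψ : ∀ b, Op R V (r b)) (x : ℕ → V) :
    evalSeq (blockComp 𝒱 φ d ψ) x =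
      φ fun b => evalSeq (ψ b) fun j =>
        koszulTwist 𝒱 (∑ c ∈ Finset.Ioi b, d c) (x (blockStart r b + j)) := by
  change (φ fun b => ψ b fun j => koszulTwist 𝒱 (∑ c ∈ Finset.Ioi b, d c)
    (x (finSigmaFinEquiv ⟨b, j⟩ : Fin _))) = _
  simp only [finSigmaFinEquiv_val]
  rfl

end Eval

/-! ### Compositions described by trees, evaluated on sequences -/

section TreeEval

variable {R V : Type*} [CommRing R] [AddCommGroup V] [Module R V]

/-- The map carried by the edge above `T`: `h` for an interior edge, the identity for a leaf. -/
def PTree.edgeMap (h : V →ₗ[R] V) : PTree → V →ₗ[R] V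
  | .leaf => LinearMap.id
  | .node _ _ _ => h

variable (𝒱 : ℤ → Submodule R V) [DirectSum.Decomposition 𝒱]
variable (μ : ∀ n, Op R V n) (h : V →ₗ[R] V)

/-- The composition `F_T` described by a tree, evaluated on a sequence. -/
def PTree.treeEval : PTree → (ℕ → V) → V
  | .leaf, x => x 0
  | .node k _ child, x => μ k fun b => (child b).edgeMap h <| (child b).treeEval fun j =>
      koszulTwist 𝒱 (∑ c ∈ Finset.Ioi b, (((child c).leaves : ℤ) - 1))
        (x (blockStart (fun c => (child c).leaves) b + j))

/-- The nested composition in which a map `A α` with `r α` inputs and of degree `d α` is attached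
to the `α`-th leaf of a tree, evaluated on a sequence. -/
def PTree.nestEval : PTree → (ℕ → ℕ) → (ℕ → ℤ) → (ℕ → (ℕ → V) → V) → (ℕ → V) → V
  | .leaf, _, _, A, x => A 0 x
  | .node k _ child, r, d, A, x => μ k fun b =>
      (child b).edgeMap h <| (child b).nestEval
        (fun α => r (blockStart (fun c => (child c).leaves) b + α))
        (fun α => d (blockStart (fun c => (child c).leaves) b + α))
        (fun α => A (blockStart (fun c => (child c).leaves) b + α))
        fun j => koszulTwist 𝒱
          (∑ c ∈ Finset.Ioi b, (((child c).leaves : ℤ) - 1 +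
            ∑ α ∈ Finset.range (child c).leaves,
              d (blockStart (fun c => (child c).leaves) c + α)))
          (x (∑ α ∈ Finset.range (blockStart (fun c => (child c).leaves) b), r α + j))

theorem PTree.treeEval_smul (T : PTree) (s : ℕ → R) (x : ℕ → V) :
    T.treeEval 𝒱 μ h (fun j => s j • x j) =
      (∏ j ∈ Finset.range T.leaves, s j) • T.treeEval 𝒱 μ h x := by
  induction T generalizing s x with
  | leaf => simp [treeEval, leaves]
  | node k hk child ih =>
    simp only [treeEval, leaves, map_smul]
    simp only [ih, map_smul]
    rw [MultilinearMap.map_smul_univ, prod_blocks]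

theorem PTree.treeEval_congr (T : PTree) {x y : ℕ → V} (hxy : ∀ j < T.leaves, x j = y j) :
    T.treeEval 𝒱 μ h x = T.treeEval 𝒱 μ h y := by
  induction T generalizing x y with
  | leaf => exact hxy 0 (by simp [leaves])
  | node k hk child ih =>
    simp only [treeEval]
    congr 1
    ext b
    congr 1
    refine ih b fun j hj => ?_
    congr 1
    refine hxy _ ?_
    have := blockStart_add_le (fun c => (child c).leaves) b
    simp only [leaves]
    omega

theorem PTree.koszul_node (k : ℕ) (hk : 2 ≤ k) (child : Fin k → PTree) (d : ℕ → ℤ) :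
    (node k hk child).koszul (fun α => d α) =
      ∑ b, ((∑ c ∈ Finset.Ioi b, (((child c).leaves : ℤ) - 1)) *
          (∑ j ∈ Finset.range (child b).leaves,
            d (blockStart (fun c => (child c).leaves) b + j)) +
        (child b).koszul fun α => d (blockStart (fun c => (child c).leaves) b + α)) := by
  rw [Finset.sum_add_distrib]
  simp only [koszul, finSigmaFinEquiv_val]
  congr 1
  simp only [← Fin.sum_univ_eq_sum_range
    (fun j => d (blockStart (fun c => (child c).leaves) _ + j)), Finset.sum_mul]
  exact Finset.sum_comm' (by simp)

/-- The Koszul sign between `F_T ∘ (A₁ ⊗ ⋯ ⊗ Aₙ)` and the nested composition. -/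
theorem PTree.treeEval_comp (T : PTree) (r : ℕ → ℕ) (d : ℕ → ℤ) (A : ℕ → (ℕ → V) → V)
    (hA : ∀ α e x, koszulTwist 𝒱 e (A α x) =
      sgn R (e * d α) • A α fun j => koszulTwist 𝒱 e (x j)) (x : ℕ → V) :
    T.treeEval 𝒱 μ h (fun α => A α fun j =>
        koszulTwist 𝒱 (∑ β ∈ Finset.Ioo α T.leaves, d β) (x (∑ β ∈ Finset.range α, r β + j))) =
      sgn R (T.koszul fun α => d α) • T.nestEval 𝒱 μ h r d A x := by
  induction T generalizing r d A x with
  | leaf =>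
    have : Finset.Ioo 0 1 = (∅ : Finset ℕ) := by decide
    simp [treeEval, nestEval, koszul, leaves, this, koszulTwist_zero, sgn_zero]
  | node k hk child ih =>
    rw [koszul_node, sgn_sum]
    simp only [treeEval, nestEval]
    rw [← MultilinearMap.map_smul_univ]
    congr 1
    ext b
    rw [← map_smul]
    congr 1
    have h1 := ih b (fun α => r (blockStart (fun c => (child c).leaves) b + α))
      (fun α => d (blockStart (fun c => (child c).leaves) b + α))
      (fun α => A (blockStart (fun c => (child c).leaves) b + α)) (fun α => hA _)
      fun j => koszulTwist 𝒱
          (∑ c ∈ Finset.Ioi b, (((child c).leaves : ℤ) - 1 +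
            ∑ α ∈ Finset.range (child c).leaves,
              d (blockStart (fun c => (child c).leaves) c + α)))
          (x (∑ α ∈ Finset.range (blockStart (fun c => (child c).leaves) b), r α + j))
    rw [sgn_add, mul_smul, ← h1, Finset.mul_sum, sgn_sum, ← treeEval_smul]
    refine treeEval_congr 𝒱 μ h _ fun j hj => ?_
    rw [hA]
    congr 2
    ext i
    rw [koszulTwist_add, koszulTwist_add, Finset.sum_range_add, add_assoc]
    congr 1
    simp only [leaves]
    rw [sum_Ioo_block _ _ _ hj, Finset.sum_add_distrib]
    congr 1
    ring

end TreeEval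

/-! ### Grafting decorated trees -/

namespace PTree

/-- The decoration of the edge above `T`: a circle for an interior edge, and `m` for a leaf. -/
def edgeMark : PTree → Option Mark → Option Mark
  | .leaf, m => m
  | .node _ _ _, _ => some Mark.circle

/-- The decorated tree obtained from `T` by decorating the interior edges by circles and
attaching the tree `S α` to the `α`-th leaf, whose edge gets the decoration `m α`. -/
def graft : PTree → (ℕ → Option Mark) → (ℕ → DecTree) → DecTree
  | .leaf, _, S => S 0
  | .node k hk child, m, S => .node k hk
      (fun b => (child b).edgeMark (m (blockStart (fun c => (child c).leaves) b)))
      fun b => (child b).graft (fun α => m (blockStart (fun c => (child c).leaves) b + α))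
        fun α => S (blockStart (fun c => (child c).leaves) b + α)

theorem leaves_graft (T : PTree) (m : ℕ → Option Mark) (S : ℕ → DecTree) :
    (T.graft m S).leaves = ∑ α ∈ Finset.range T.leaves, (S α).leaves := by
  induction T generalizing m S with
  | leaf => simp [graft, leaves]
  | node k hk child ih =>
    simp only [graft, leaves, DecTree.leaves, ih]
    exact sum_blocks (fun c => (child c).leaves) fun α => (S α).leaves

theorem degree_graft (T : PTree) (m : ℕ → Option Mark) (S : ℕ → DecTree) :
    DecTree.markDegree (T.edgeMark (m 0)) + (T.graft m S).degree =
      (T.leaves : ℤ) - 1 +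
        ∑ α ∈ Finset.range T.leaves, (DecTree.markDegree (m α) + (S α).degree) := by
  induction T generalizing m S with
  | leaf => simp [graft, leaves, edgeMark]
  | node k hk child ih =>
    have ih' := fun b => ih b (fun α => m (blockStart (fun c => (child c).leaves) b + α))
        fun α => S (blockStart (fun c => (child c).leaves) b + α)
    simp only [add_zero] at ih'
    change 1 + _ = _
    simp only [graft, leaves, DecTree.degree, ih']
    rw [Finset.sum_add_distrib, Finset.sum_sub_distrib,
      sum_blocks (fun c => (child c).leaves) fun α => DecTree.markDegree (m α) + (S α).degree]
    push_cast
    simp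
    ring

theorem graft_congr (T : PTree) {m m' : ℕ → Option Mark} {S S' : ℕ → DecTree}
    (hm : ∀ α < T.leaves, m α = m' α) (hS : ∀ α < T.leaves, S α = S' α) :
    T.graft m S = T.graft m' S' := by
  induction T generalizing m m' S S' with
  | leaf => exact hS 0 (by simp [leaves])
  | node k hk child ih =>
    have hlt : ∀ b j, j < (child b).leaves →
        blockStart (fun c => (child c).leaves) b + j < (node k hk child).leaves := by
      intro b j hj
      have := blockStart_add_le (fun c => (child c).leaves) b
      simp only [leaves]
      omega
    simp only [graft, DecTree.node.injEq, heq_eq_eq, true_and]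
    refine ⟨funext fun b => ?_, funext fun b => ?_⟩
    · cases hc : child b with
      | leaf =>
        refine hm _ ?_
        simpa using hlt b 0 (by simp [hc, leaves])
      | node => rfl
    · exact ih b (fun α hα => hm _ (hlt b α hα)) fun α hα => hS _ (hlt b α hα)

end PTree

section Flow

variable {R V : Type*} [CommRing R] [AddCommGroup V] [Module R V]
variable (𝒱 : ℤ → Submodule R V) [DirectSum.Decomposition 𝒱]
variable (μ : ∀ n, Op R V n) (h e : V →ₗ[R] V)

theorem DecTree.evalSeq_flow_node (k : ℕ) (hk : 2 ≤ k) (mark : Fin k → Option Mark)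
    (child : Fin k → DecTree) (x : ℕ → V) :
    evalSeq ((node k hk mark child).flow 𝒱 μ h e) x =
      μ k fun b => markMap h e (mark b) <| evalSeq ((child b).flow 𝒱 μ h e) fun j =>
        koszulTwist 𝒱 (∑ c ∈ Finset.Ioi b, (markDegree (mark c) + (child c).degree))
          (x (blockStart (fun c => (child c).leaves) b + j)) := by
  simp only [flow]
  exact evalSeq_blockComp _ _ _ _ _

theorem koszulTwist_flow
    (hh : ∀ i, ∀ x ∈ 𝒱 i, h x ∈ 𝒱 (i + 1)) (he : ∀ i, ∀ x ∈ 𝒱 i, e x ∈ 𝒱 i)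
    (hμ : ∀ n : ℕ, 2 ≤ n → ∀ (a : Fin n → ℤ) (x : Fin n → V), (∀ j, x j ∈ 𝒱 (a j)) →
      μ n x ∈ 𝒱 ((∑ j, a j) + n - 2)) (S : DecTree) (m : Option Mark) (t : ℤ) (x : ℕ → V) :
    koszulTwist 𝒱 t (DecTree.markMap h e m (evalSeq (S.flow 𝒱 μ h e) x)) =
      sgn R (t * (DecTree.markDegree m + S.degree)) •
        DecTree.markMap h e m (evalSeq (S.flow 𝒱 μ h e) fun j => koszulTwist 𝒱 t (x j)) := by
  have hmark : ∀ (m : Option Mark) (y : V), koszulTwist 𝒱 t (DecTree.markMap h e m y) =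
      sgn R (t * DecTree.markDegree m) • DecTree.markMap h e m (koszulTwist 𝒱 t y) := by
    intro m y
    refine koszulTwist_linearMap 𝒱 (fun i x hx => ?_) t y
    rcases m with _ | _ | _
    · simpa [DecTree.markDegree, DecTree.markMap] using hx
    · exact hh i x hx
    · simpa [DecTree.markDegree, DecTree.markMap] using he i x hx
  suffices hS : ∀ x : ℕ → V, koszulTwist 𝒱 t (evalSeq (S.flow 𝒱 μ h e) x) =
      sgn R (t * S.degree) • evalSeq (S.flow 𝒱 μ h e) fun j => koszulTwist 𝒱 t (x j) by
    rw [hmark, hS, map_smul, smul_smul, ← sgn_add, mul_add]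
  induction S with
  | leaf =>
    intro x
    simp [DecTree.flow, DecTree.degree, sgn_zero]
    rfl
  | node k hk mark child ih =>
    intro x
    have hop : ∀ y : Fin k → V, koszulTwist 𝒱 t (μ k y) =
        sgn R (t * (k - 2)) • μ k fun j => koszulTwist 𝒱 t (y j) :=
      koszulTwist_op 𝒱 (fun a x hx => by rw [← add_sub_assoc]; exact hμ k hk a x hx) t
    rw [DecTree.evalSeq_flow_node, DecTree.evalSeq_flow_node, hop]
    simp only [hmark, ih, map_smul, smul_smul, ← sgn_add, ← mul_add]
    rw [MultilinearMap.map_smul_univ, smul_smul, ← sgn_sum, ← sgn_add, ← Finset.mul_sum, ← mul_add]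
    simp only [koszulTwist_comm 𝒱 t, DecTree.degree]

/-- The flow chart of a grafted tree is a nested composition. -/
theorem PTree.nestEval_flow (T : PTree) (m : ℕ → Option Mark) (S : ℕ → DecTree) (x : ℕ → V) :
    DecTree.markMap h e (T.edgeMark (m 0)) (evalSeq ((T.graft m S).flow 𝒱 μ h e) x) =
      T.edgeMap h (T.nestEval 𝒱 μ h (fun α => (S α).leaves)
        (fun α => DecTree.markDegree (m α) + (S α).degree)
        (fun α x => DecTree.markMap h e (m α) (evalSeq ((S α).flow 𝒱 μ h e) x)) x) ∧
    (T ≠ leaf → evalSeq ((T.graft m S).flow 𝒱 μ h e) x =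
      T.nestEval 𝒱 μ h (fun α => (S α).leaves)
        (fun α => DecTree.markDegree (m α) + (S α).degree)
        (fun α x => DecTree.markMap h e (m α) (evalSeq ((S α).flow 𝒱 μ h e) x)) x) := by
  induction T generalizing m S x with
  | leaf => exact ⟨rfl, fun h => absurd rfl h⟩
  | node k hk child ih =>
    suffices hn : evalSeq (((node k hk child).graft m S).flow 𝒱 μ h e) x =
        (node k hk child).nestEval 𝒱 μ h (fun α => (S α).leaves)
        (fun α => DecTree.markDegree (m α) + (S α).degree)
        (fun α x => DecTree.markMap h e (m α) (evalSeq ((S α).flow 𝒱 μ h e) x)) x from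
      ⟨congrArg h hn, fun _ => hn⟩
    simp only [graft, nestEval]
    rw [DecTree.evalSeq_flow_node]
    congr 1
    ext b
    have h1 := fun c x => (ih c (fun α => m (blockStart (fun c => (child c).leaves) c + α))
      (fun α => S (blockStart (fun c => (child c).leaves) c + α)) x).1
    have h2 := fun c => degree_graft (child c)
      (fun α => m (blockStart (fun c => (child c).leaves) c + α))
      (fun α => S (blockStart (fun c => (child c).leaves) c + α))
    simp only [add_zero] at h1 h2
    rw [h1]
    simp only [h2, leaves_graft]
    rw [sum_range_blockStart (fun c => (child c).leaves) fun α => (S α).leaves]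

end Flow

/-! ### The p-kernel as a sum over planar trees -/

namespace PTree

theorem leaves_pos (T : PTree) : 0 < T.leaves := by
  induction T with
  | leaf => simp [leaves]
  | node k hk child ih =>
    have : ∑ b : Fin k, 1 ≤ ∑ b, (child b).leaves := Finset.sum_le_sum fun b _ => ih b
    simp only [Finset.sum_const, Finset.card_univ, Fintype.card_fin, smul_eq_mul] at this
    simp only [leaves]
    omega

theorem arity_le_leaves (k : ℕ) (hk : 2 ≤ k) (child : Fin k → PTree) :
    k ≤ (node k hk child).leaves := by
  have : ∑ b : Fin k, 1 ≤ ∑ b, (child b).leaves :=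
    Finset.sum_le_sum fun b _ => leaves_pos (child b)
  simpa [leaves] using this

theorem eq_leaf_of_leaves_eq_one {T : PTree} (hT : T.leaves = 1) : T = leaf := by
  cases T with
  | leaf => rfl
  | node k hk child =>
    have := arity_le_leaves k hk child
    omega

theorem node_cast {k l : ℕ} (hkl : k = l) (hk : 2 ≤ k) (hl : 2 ≤ l) (child : Fin k → PTree) :
    node l hl (fun b => child (Fin.cast hkl.symm b)) = node k hk child := by
  subst hkl
  rfl

/-- The list of the trees attached to the root. -/
def children : PTree → List PTree
  | leaf => []
  | node _ _ child => List.ofFn child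

theorem exists_composition {n : ℕ} {T : PTree} (hn : T.leaves = n) (hT : T ≠ leaf) :
    ∃ (c : Composition n) (hc : 2 ≤ c.length)
      (t : ∀ b, {T : PTree // T.leaves = c.blocksFun b}),
      T = node c.length hc fun b => (t b).1 := by
  cases T with
  | leaf => exact absurd rfl hT
  | node k hk child =>
    let c : Composition n := ⟨List.ofFn fun b => (child b).leaves, by
      intro i hi
      obtain ⟨b, rfl⟩ := (List.mem_ofFn' _ _).1 hi
      exact leaves_pos _, by rw [List.sum_ofFn]; exact hn⟩
    have hlen : c.length = k := List.length_ofFn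
    refine ⟨c, hlen.symm ▸ hk, fun b => ⟨child (Fin.cast hlen b), ?_⟩, ?_⟩
    · simp [Composition.blocksFun, c, Fin.cast]
    · exact (node_cast hlen.symm hk _ child).symm

/-- Summation over trees by the sizes of the trees attached to the root. -/
theorem node_bijective {n : ℕ} {p : Composition n → Prop} {Q : PTree → Prop}
    (hp : ∀ c, p c → 2 ≤ c.length)
    (hpQ : ∀ c (hc : p c) (t : ∀ b, {T : PTree // T.leaves = c.blocksFun b}),
      Q (node c.length (hp c hc) fun b => (t b).1))
    (hQ : ∀ T, Q T → T.leaves = n ∧ T ≠ leaf)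
    (hQp : ∀ c (hc : 2 ≤ c.length) (t : ∀ b, {T : PTree // T.leaves = c.blocksFun b}),
      Q (node c.length hc fun b => (t b).1) → p c) :
    Function.Bijective
      (fun x => ⟨node x.1.1.length (hp _ x.1.2) fun b => (x.2 b).1, hpQ _ x.1.2 x.2⟩ :
        (Σ c : {c : Composition n // p c}, ∀ b, {T : PTree // T.leaves = c.1.blocksFun b}) →
          {T // Q T}) := by
  constructor
  · rintro ⟨⟨c, hc⟩, t⟩ ⟨⟨c', hc'⟩, t'⟩ heq
    have heq : node c.length (hp _ hc) (fun b => (t b).1) =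
        node c'.length (hp _ hc') fun b => (t' b).1 := congrArg Subtype.val heq
    have hcc : c = c' := by
      have h1 : ∀ (c : Composition n) (hc : 2 ≤ c.length)
          (t : ∀ b, {T : PTree // T.leaves = c.blocksFun b}),
          c.blocks = ((node c.length hc fun b => (t b).1).children).map leaves := by
        intro c hc t
        simp only [children, List.map_ofFn]
        rw [← c.ofFn_blocksFun]
        exact congrArg List.ofFn (funext fun b => (t b).2.symm)
      ext1
      rw [h1 c (hp _ hc) t, h1 c' (hp _ hc') t', heq]
    subst hcc
    simp only [node.injEq, heq_eq_eq, true_and] at heq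
    have : t = t' := funext fun b => Subtype.ext (congrFun heq b)
    rw [this]
  · rintro ⟨T, hT⟩
    obtain ⟨c, hc, t, rfl⟩ := exists_composition (hQ T hT).1 (hQ T hT).2
    exact ⟨⟨⟨c, hQp c hc t hT⟩, t⟩, rfl⟩

instance finite_leaves_eq (n : ℕ) : Finite {T : PTree // T.leaves = n} := by
  induction n using Nat.strong_induction_on with
  | _ n ih =>
    have hfin : Set.Finite {T : PTree | T.leaves = n ∧ T ≠ leaf} := by
      have (c : {c : Composition n // 2 ≤ c.length}) :
          Finite (∀ b, {T : PTree // T.leaves = c.1.blocksFun b}) :=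
        @Pi.finite _ _ _ fun b => ih _ (blocksFun_lt c.1 c.2 b)
      refine Finite.of_surjective _ (node_bijective (n := n) (p := fun c => 2 ≤ c.length)
        (Q := fun T => T.leaves = n ∧ T ≠ leaf) (fun _ h => h) ?_ (fun T h => h)
        fun c hc _ _ => hc).2
      intro c hc t
      refine ⟨?_, by simp⟩
      simp only [leaves, fun b => (t b).2]
      exact c.sum_blocksFun
    refine Set.Finite.subset (s := {T | T.leaves = n ∧ T ≠ leaf} ∪ {leaf})
      (hfin.union (Set.finite_singleton _)) fun T hT => ?_
    by_cases h : T = leaf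
    · exact Or.inr h
    · exact Or.inl ⟨hT, h⟩

instance (n : ℕ) : Fintype {T : PTree // T.leaves = n} := Fintype.ofFinite _

/-- All leaves of `T` from the `i`-th one (counted from zero) on are attached to the root. -/
def RootFrom (i : ℕ) : PTree → Prop
  | leaf => False
  | node _ _ child => ∀ b, i < blockStart (fun c => (child c).leaves) b + (child b).leaves →
      child b = leaf

instance (n i : ℕ) : Finite {T : PTree // T.leaves = n ∧ T.RootFrom i} :=
  Finite.of_injective (fun T => (⟨T.1, T.2.1⟩ : {T : PTree // T.leaves = n}))
    fun _ _ h => Subtype.ext (congrArg (fun T => T.1) h)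

instance (n i : ℕ) : Fintype {T : PTree // T.leaves = n ∧ T.RootFrom i} := Fintype.ofFinite _

end PTree

theorem sizeUpTo_eq_blockStart {n : ℕ} (c : Composition n) (b : Fin c.length) :
    c.sizeUpTo b = blockStart c.blocksFun b := by
  rw [Composition.sizeUpTo, ← c.ofFn_blocksFun, List.sum_take_ofFn, blockStart]
  refine Finset.sum_congr ?_ fun _ _ => rfl
  ext; simp

theorem forall_index_blocksFun_iff {n : ℕ} (c : Composition n) (i : Fin n) :
    (∀ m, i ≤ m → c.blocksFun (c.index m) = 1) ↔
      ∀ b, (i : ℕ) < blockStart c.blocksFun b + c.blocksFun b → c.blocksFun b = 1 := by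
  constructor
  · intro hm b hb
    have hpos : 0 < c.blocksFun b := c.blocks_pos (c.blocksFun_mem_blocks b)
    have h1 := hm (c.embedding b ⟨c.blocksFun b - 1, by omega⟩) (by
      rw [Fin.le_def, Composition.coe_embedding, sizeUpTo_eq_blockStart]
      simp only
      omega)
    rwa [c.index_embedding] at h1
  · intro hb m him
    refine hb _ ?_
    have h1 := c.lt_sizeUpTo_index_succ m
    have h2 := c.sizeUpTo_succ' (c.index m)
    rw [sizeUpTo_eq_blockStart] at h2
    simp only [Fin.val_succ] at h1 h2
    have h3 : (i : ℕ) ≤ m := him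
    omega

theorem even_theta_append_ones (l r : List ℕ) (hr : ∀ x ∈ r, x = 1) :
    Even ((theta (l ++ r) : ℤ) - theta l) := by
  have hsum : ∀ (u : ℕ) (r : List ℕ), (∀ x ∈ r, x = 1) →
      (r.map fun w => u * (w + 1)).sum = 2 * (u * r.length) := by
    intro u r hr
    rw [List.eq_replicate_of_mem hr]
    simp
    ring
  induction l with
  | nil =>
    simp only [List.nil_append, theta, Nat.cast_zero, sub_zero]
    induction r with
    | nil => simp [theta]
    | cons a r ih =>
      simp only [theta]
      rw [hsum a r fun x hx => hr x (List.mem_cons_of_mem _ hx)]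
      push_cast
      exact (even_two_mul _).add (ih fun x hx => hr x (List.mem_cons_of_mem _ hx))
  | cons u l ih =>
    simp only [List.cons_append, theta, List.map_append, List.sum_append]
    rw [hsum u r hr]
    have h := (even_two_mul ((u : ℤ) * r.length)).add ih
    push_cast
    ring_nf at h ⊢
    exact h

theorem even_theta_take_index {n : ℕ} (c : Composition n) (i : Fin n)
    (hc : ∀ m, i ≤ m → c.blocksFun (c.index m) = 1) :
    Even ((theta c.blocks : ℤ) - theta (c.blocks.take (c.index i))) := by
  have h := even_theta_append_ones (c.blocks.take (c.index i)) (c.blocks.drop (c.index i)) ?_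
  · rwa [List.take_append_drop] at h
  · intro x hx
    obtain ⟨j, hj, rfl⟩ := List.mem_drop_iff_getElem.1 hx
    simp only [add_comm _ j]
    refine (forall_index_blocksFun_iff c i).1 hc ⟨j + c.index i, hj⟩ ?_
    have h1 := c.lt_sizeUpTo_index_succ i
    have h2 := c.sizeUpTo_succ' ⟨j + c.index i, hj⟩
    rw [sizeUpTo_eq_blockStart c ⟨j + c.index i, hj⟩] at h2
    rw [← h2]
    refine lt_of_lt_of_le h1 (c.monotone_sizeUpTo ?_)
    simp

section Kernels

variable {R V : Type*} [CommRing R] [AddCommGroup V] [Module R V]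
variable (𝒱 : ℤ → Submodule R V) [DirectSum.Decomposition 𝒱]
variable (μ : ∀ n, Op R V n) (h : V →ₗ[R] V)

theorem evalSeq_blockComp_trees {n : ℕ} (c : Composition n) (hc : 2 ≤ c.length)
    (hW : ∀ b x, evalSeq (withH h _ (pKernel 𝒱 μ h (c.blocksFun b))) x =
      ∑ T : {T : PTree // T.leaves = c.blocksFun b},
        sgn R T.1.vartheta • T.1.edgeMap h (T.1.treeEval 𝒱 μ h x)) (x : ℕ → V) :
    sgn R (theta c.blocks) • evalSeq (castOp c.sum_blocksFun
        (blockComp 𝒱 (μ c.length) (fun b => (c.blocksFun b : ℤ) - 1)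
          fun b => withH h _ (pKernel 𝒱 μ h (c.blocksFun b)))) x =
      ∑ t : (∀ b, {T : PTree // T.leaves = c.blocksFun b}),
        sgn R (PTree.node c.length hc fun b => (t b).1).vartheta •
          (PTree.node c.length hc fun b => (t b).1).treeEval 𝒱 μ h x := by
  classical
  rw [evalSeq_castOp, evalSeq_blockComp]
  simp only [hW]
  rw [MultilinearMap.map_sum, Finset.smul_sum]
  refine Finset.sum_congr rfl fun t _ => ?_
  have ht : ∀ b, (t b).1.leaves = c.blocksFun b := fun b => (t b).2
  rw [MultilinearMap.map_smul_univ, smul_smul, ← sgn_sum, ← sgn_add]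
  simp only [PTree.treeEval, PTree.vartheta, ht, c.ofFn_blocksFun]
  push_cast
  rfl

theorem evalSeq_withH_pKernel (n : ℕ) (hn : 0 < n) (x : ℕ → V) :
    evalSeq (withH h n (pKernel 𝒱 μ h n)) x = ∑ T : {T : PTree // T.leaves = n},
      sgn R T.1.vartheta • T.1.edgeMap h (T.1.treeEval 𝒱 μ h x) := by
  induction n using Nat.strong_induction_on generalizing x with
  | _ n ih =>
    obtain rfl | hn2 : n = 1 ∨ 2 ≤ n := by omega
    · let : Unique {T : PTree // T.leaves = 1} :=
        { default := ⟨PTree.leaf, rfl⟩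
          uniq := fun T => Subtype.ext (PTree.eq_leaf_of_leaves_eq_one T.2) }
      rw [Fintype.sum_unique]
      change x 0 = sgn R (PTree.leaf.vartheta : ℤ) • x 0
      simp [PTree.vartheta, sgn_zero]
    · have hleaf : ∀ T : PTree, T.leaves = n → T ≠ PTree.leaf := by
        rintro T hT rfl
        simp only [PTree.leaves] at hT
        omega
      have hw : ∀ φ : Op R V n, evalSeq (withH h n φ) x = h (evalSeq φ x) := by
        intro φ
        obtain ⟨m, rfl⟩ : ∃ m, n = m + 2 := ⟨n - 2, by omega⟩
        rfl
      have hh : ∀ T : {T : PTree // T.leaves = n},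
          T.1.edgeMap h (T.1.treeEval 𝒱 μ h x) = h (T.1.treeEval 𝒱 μ h x) := by
        rintro ⟨T, hT⟩
        cases T with
        | leaf => exact absurd rfl (hleaf _ hT)
        | node => rfl
      simp only [hh, ← map_smul, ← map_sum, hw]
      congr 1
      have hbij := PTree.node_bijective (n := n) (p := fun c => 2 ≤ c.length)
        (Q := fun T => T.leaves = n) (fun _ h => h) (fun c hc t => by
          simp only [PTree.leaves, fun b => (t b).2]
          exact c.sum_blocksFun) (fun T h => ⟨h, hleaf T h⟩) fun c hc _ _ => hc
      rw [pKernel, evalSeq_sum,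
        ← hbij.sum_comp fun T => sgn R T.1.vartheta • T.1.treeEval 𝒱 μ h x, Fintype.sum_sigma]
      refine Finset.sum_congr rfl fun c _ => ?_
      rw [evalSeq_negOnePow_smul]
      exact evalSeq_blockComp_trees 𝒱 μ h c.1 c.2 (fun b x => ih _ (blocksFun_lt c.1 c.2 b)
        (c.1.blocks_pos (c.1.blocksFun_mem_blocks b)) x) x

theorem evalSeq_pKernelAt (n : ℕ) (i : Fin n) (x : ℕ → V) :
    evalSeq (pKernelAt 𝒱 μ h n i) x = ∑ T : {T : PTree // T.leaves = n ∧ T.RootFrom i},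
      sgn R T.1.vartheta • T.1.treeEval 𝒱 μ h x := by
  have hroot : ∀ (c : Composition n) (hc : 2 ≤ c.length)
      (t : ∀ b, {T : PTree // T.leaves = c.blocksFun b}),
      (PTree.node c.length hc fun b => (t b).1).RootFrom i ↔
        ∀ m, i ≤ m → c.blocksFun (c.index m) = 1 := by
    intro c hc t
    rw [forall_index_blocksFun_iff]
    simp only [PTree.RootFrom, fun b => (t b).2]
    refine forall_congr' fun b => imp_congr_right fun _ => ?_
    exact ⟨fun h => by rw [← (t b).2, h]; rfl,
      fun h => PTree.eq_leaf_of_leaves_eq_one ((t b).2.trans h)⟩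
  have hbij := PTree.node_bijective (n := n)
    (p := fun c => 2 ≤ c.length ∧ ∀ m, i ≤ m → c.blocksFun (c.index m) = 1)
    (Q := fun T => T.leaves = n ∧ T.RootFrom i) (fun _ h => h.1) (fun c hc t => by
      refine ⟨?_, (hroot c hc.1 t).2 hc.2⟩
      simp only [PTree.leaves, fun b => (t b).2]
      exact c.sum_blocksFun) (fun T h => ⟨h.1, by rintro rfl; exact h.2⟩)
    fun c hc t h => ⟨hc, (hroot c hc t).1 h.2⟩
  rw [pKernelAt, evalSeq_sum,
    ← hbij.sum_comp fun T => sgn R T.1.vartheta • T.1.treeEval 𝒱 μ h x, Fintype.sum_sigma]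
  refine Finset.sum_congr rfl fun c _ => ?_
  rw [evalSeq_negOnePow_smul, ← sgn_congr R (even_theta_take_index c.1 i c.2.2)]
  exact evalSeq_blockComp_trees 𝒱 μ h c.1 c.2.1 (fun b x => evalSeq_withH_pKernel 𝒱 μ h _
    (c.1.blocks_pos (c.1.blocksFun_mem_blocks b)) x) x

end Kernels

/-! ### Carp trees, recursively -/

namespace DecTree

/-- The decorated trees that occur in the expansion of the q-kernel (`true`), and those that
occur in the expansion of `p_n (gf q ⊗ ⋯ ⊗ gf q)` (`false`). -/
def IsKernelTree : Bool → DecTree → Prop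
  | true, leaf => True
  | false, leaf => False
  | true, node _ _ mark child =>
    ∃ j, (∀ b < j, (mark b = some Mark.circle ∧ IsKernelTree false (child b)) ∨
        (mark b = some Mark.dot ∧ IsKernelTree true (child b))) ∧
      mark j = some Mark.circle ∧ IsKernelTree true (child j) ∧
      ∀ b, j < b → mark b = none ∧ child b = leaf
  | false, node _ _ mark child =>
    ∀ b, (mark b = some Mark.circle ∧ IsKernelTree false (child b)) ∨
      (mark b = some Mark.dot ∧ IsKernelTree true (child b))

section Address

variable {k : ℕ} {hk : 2 ≤ k} {mark : Fin k → Option Mark} {child : Fin k → DecTree}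

theorem not_isVertex_leaf (v : List ℕ) : ¬ leaf.IsVertex v := by
  rintro ⟨k, hk, mark, child, h⟩
  cases v <;> simp [subtree?] at h

theorem isVertex_nil_iff {S : DecTree} : S.IsVertex [] ↔ S ≠ leaf := by
  cases S with
  | leaf => simp [not_isVertex_leaf]
  | node k hk mark child => simp [IsVertex, subtree?, hk]

theorem isVertex_cons_iff {i : ℕ} {v : List ℕ} :
    (node k hk mark child).IsVertex (i :: v) ↔ ∃ b : Fin k, i = b ∧ (child b).IsVertex v := by
  by_cases hi : i < k
  · simp only [IsVertex, subtree?, hi, dif_pos]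
    constructor
    · exact fun h => ⟨⟨i, hi⟩, rfl, h⟩
    · rintro ⟨b, rfl, h⟩
      exact h
  · simp only [IsVertex, subtree?, hi, dif_neg, not_false_eq_true]
    constructor
    · rintro ⟨_, _, _, _, h⟩
      exact absurd h (by simp)
    · rintro ⟨b, rfl, h⟩
      exact absurd b.2 hi

@[simp]
theorem isVertex_cons {b : Fin k} {v : List ℕ} :
    (node k hk mark child).IsVertex (b :: v) ↔ (child b).IsVertex v := by
  rw [isVertex_cons_iff]
  exact ⟨by rintro ⟨c, hc, h⟩; rwa [Fin.ext hc], fun h => ⟨b, rfl, h⟩⟩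

theorem isEdge_node_iff {e : List ℕ} :
    (node k hk mark child).IsEdge e ↔
      ∃ b : Fin k, e = [↑b] ∨ ∃ e', e = ↑b :: e' ∧ (child b).IsEdge e' := by
  cases e with
  | nil => simp [IsEdge]
  | cons i e =>
    by_cases hi : i < k
    · constructor
      · intro h
        refine ⟨⟨i, hi⟩, ?_⟩
        by_cases he : e = []
        · exact Or.inl (by simp [he])
        · refine Or.inr ⟨e, rfl, he, ?_⟩
          simpa [IsEdge, subtree?, hi] using h
      · rintro ⟨b, h | ⟨e', h, h'⟩⟩
        · simp only [List.cons.injEq] at h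
          obtain ⟨rfl, rfl⟩ := h
          simp [IsEdge, subtree?]
        · simp only [List.cons.injEq] at h
          obtain ⟨rfl, rfl⟩ := h
          simpa [IsEdge, subtree?] using h'.2
    · constructor
      · intro h
        simp [IsEdge, subtree?, hi] at h
      · rintro ⟨b, h | ⟨e', h, h'⟩⟩ <;>
        · simp only [List.cons.injEq] at h
          exact absurd (h.1 ▸ b.2) hi

theorem markAt_singleton (b : Fin k) : (node k hk mark child).markAt [↑b] = mark b := by
  simp [markAt]

theorem markAt_cons (b : Fin k) {e : List ℕ} (he : e ≠ []) :
    (node k hk mark child).markAt (b :: e) = (child b).markAt e := by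
  cases e with
  | nil => exact absurd rfl he
  | cons j a => simp [markAt]

theorem crosses_nil_iff {e : List ℕ} :
    (node k hk mark child).Crosses [] e ↔ ∃ b : Fin k, e = [↑b] := by
  constructor
  · rintro ⟨-, he, h, -⟩
    obtain ⟨b, h' | ⟨e', rfl, he'⟩⟩ := isEdge_node_iff.1 he
    · exact ⟨b, h'⟩
    · obtain ⟨j, a, rfl⟩ := List.exists_cons_of_ne_nil he'.1
      simp [VertexLT] at h
  · rintro ⟨b, rfl⟩
    exact ⟨isVertex_nil_iff.2 (by simp), isEdge_node_iff.2 ⟨b, Or.inl rfl⟩, Or.inl rfl,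
      List.nil_lt_cons _ _⟩

theorem crosses_cons_iff {i : Fin k} {v e : List ℕ} :
    (node k hk mark child).Crosses (i :: v) e ↔
      ((child i).IsVertex v ∧ ∃ b : Fin k, i < b ∧ e = [↑b]) ∨
        ∃ e', e = ↑i :: e' ∧ (child i).Crosses v e' := by
  constructor
  · rintro ⟨hv, he, h1, h2⟩
    rw [isVertex_cons] at hv
    obtain ⟨b, rfl | ⟨e', rfl, he'⟩⟩ := isEdge_node_iff.1 he
    · refine Or.inl ⟨hv, b, ?_, rfl⟩
      simpa [List.cons_lt_cons_iff] using h2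
    · obtain ⟨j, a, rfl⟩ := List.exists_cons_of_ne_nil he'.1
      have hbi : b = i := by
        rw [List.cons_lt_cons_iff] at h2
        simp only [List.dropLast_cons_cons, List.cons.injEq, VertexLT, List.cons_lt_cons_iff] at h1
        apply Fin.ext
        omega
      subst hbi
      refine Or.inr ⟨_, rfl, hv, he', ?_, ?_⟩
      · simpa [VertexLT, List.cons_lt_cons_iff] using h1
      · simpa [List.cons_lt_cons_iff] using h2
  · rintro (⟨hv, b, hb, rfl⟩ | ⟨e', rfl, hv, he, h1, h2⟩)
    · refine ⟨isVertex_cons.2 hv, isEdge_node_iff.2 ⟨b, Or.inl rfl⟩, Or.inr ?_, ?_⟩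
      · simp [VertexLT]
      · simp [List.cons_lt_cons_iff, hb]
    · refine ⟨isVertex_cons.2 hv, isEdge_node_iff.2 ⟨i, Or.inr ⟨_, rfl, he⟩⟩, ?_, ?_⟩
      · obtain ⟨j, a, rfl⟩ := List.exists_cons_of_ne_nil he.1
        simpa [VertexLT, List.cons_lt_cons_iff] using h1
      · simpa [List.cons_lt_cons_iff] using h2

end Address

/-! #### The condition on a single line -/

/-- The line of `v` carries some dots followed by a circle. -/
def LineClosed (S : DecTree) (line : List ℕ → List ℕ) (v : List ℕ) : Prop :=
  ∃ e₀, S.Crosses v e₀ ∧ (S.markAt e₀ = some Mark.circle ∧ line e₀ = v) ∧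
    (∀ e, S.Crosses v e → e < e₀ → S.markAt e = some Mark.dot ∧ line e = v) ∧
    (∀ e, S.Crosses v e → e₀ < e → ¬ (S.markAt e ≠ none ∧ line e = v))

/-- All crossing points on the line of `v` are decorated by dots. -/
def LineOpen (S : DecTree) (line : List ℕ → List ℕ) (v : List ℕ) : Prop :=
  ∀ e, S.Crosses v e → S.markAt e = some Mark.dot ∧ line e = v

/-- Decorations are placed at crossings, and interior edges are decorated. -/
def LinesValid (S : DecTree) (line : List ℕ → List ℕ) : Prop :=
  (∀ e, S.IsEdge e → S.markAt e ≠ none → S.Crosses (line e) e) ∧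
    ∀ e, S.IsEdge e → S.IsVertex e → S.markAt e ≠ none

theorem isCarp_iff {S : DecTree} :
    S.IsCarp ↔ ∃ line, S.LinesValid line ∧ ∀ v, S.IsVertex v → S.LineClosed line v :=
  ⟨fun ⟨⟨line, h1, h2⟩, h3⟩ => ⟨line, ⟨h1, h3⟩, h2⟩, fun ⟨line, ⟨h1, h3⟩, h2⟩ => ⟨⟨line, h1, h2⟩, h3⟩⟩

theorem LineClosed.not_lineOpen {S : DecTree} {line : List ℕ → List ℕ} {v : List ℕ}
    (h : S.LineClosed line v) : ¬ S.LineOpen line v := by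
  intro h'
  obtain ⟨e, he, h1, -⟩ := h
  have := (h' e he).1
  rw [h1.1] at this
  exact absurd this (by decide)

section Top

variable {k : ℕ}

/-- From the input `s` of the root on, the line `v` carries some dots followed by a circle. -/
def TopClosed (mark : Fin k → Option Mark) (owner : Fin k → List ℕ) (v : List ℕ) (s : ℕ) : Prop :=
  ∃ j : Fin k, s ≤ j ∧ (mark j = some Mark.circle ∧ owner j = v) ∧
    (∀ b : Fin k, s ≤ b → b < j → mark b = some Mark.dot ∧ owner b = v) ∧
    ∀ b : Fin k, j < b → ¬ (mark b ≠ none ∧ owner b = v)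

/-- From the input `s` of the root on, all inputs carry a dot on the line `v`. -/
def TopOpen (mark : Fin k → Option Mark) (owner : Fin k → List ℕ) (v : List ℕ) (s : ℕ) : Prop :=
  ∀ b : Fin k, s ≤ b → mark b = some Mark.dot ∧ owner b = v

/-- From the input `s` of the root on, no input carries a decoration on the line `v`. -/
def TopFree (mark : Fin k → Option Mark) (owner : Fin k → List ℕ) (v : List ℕ) (s : ℕ) : Prop :=
  ∀ b : Fin k, s ≤ b → ¬ (mark b ≠ none ∧ owner b = v)

variable {hk : 2 ≤ k} {mark : Fin k → Option Mark} {child : Fin k → DecTree}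
variable {line : List ℕ → List ℕ}

/-- The lines of a tree, restricted to the subtree at the `i`-th input of the root. -/
def subLine (line : List ℕ → List ℕ) (i : ℕ) (e : List ℕ) : List ℕ := (line (i :: e)).tail

theorem lineClosed_nil_iff : (node k hk mark child).LineClosed line [] ↔
    TopClosed mark (fun b => line [↑b]) [] 0 := by
  constructor
  · rintro ⟨e, he, h1, h2, h3⟩
    obtain ⟨j, rfl⟩ := crosses_nil_iff.1 he
    rw [markAt_singleton] at h1
    refine ⟨j, Nat.zero_le _, h1, fun b _ hb => ?_, fun b hb => ?_⟩
    · rw [← markAt_singleton (hk := hk) (mark := mark) (child := child)]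
      exact h2 _ (crosses_nil_iff.2 ⟨b, rfl⟩) (by simp [List.cons_lt_cons_iff, hb])
    · rw [← markAt_singleton (hk := hk) (mark := mark) (child := child)]
      exact h3 _ (crosses_nil_iff.2 ⟨b, rfl⟩) (by simp [List.cons_lt_cons_iff, hb])
  · rintro ⟨j, -, h1, h2, h3⟩
    refine ⟨[↑j], crosses_nil_iff.2 ⟨j, rfl⟩, by rwa [markAt_singleton], ?_, ?_⟩
    · rintro e he hlt
      obtain ⟨b, rfl⟩ := crosses_nil_iff.1 he
      rw [markAt_singleton]
      exact h2 b (Nat.zero_le _) (by simpa [List.cons_lt_cons_iff] using hlt)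
    · rintro e he hlt
      obtain ⟨b, rfl⟩ := crosses_nil_iff.1 he
      rw [markAt_singleton]
      exact h3 b (by simpa [List.cons_lt_cons_iff] using hlt)

theorem lineOpen_nil_iff : (node k hk mark child).LineOpen line [] ↔
    TopOpen mark (fun b => line [↑b]) [] 0 := by
  constructor
  · intro h b _
    rw [← markAt_singleton (hk := hk) (mark := mark) (child := child)]
    exact h _ (crosses_nil_iff.2 ⟨b, rfl⟩)
  · intro h e he
    obtain ⟨b, rfl⟩ := crosses_nil_iff.1 he
    rw [markAt_singleton]
    exact h b (Nat.zero_le _)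

/-- Decorations in the subtree at the `i`-th input sit on lines of this subtree. -/
def LineCompatible (k : ℕ) (child : Fin k → DecTree) (line : List ℕ → List ℕ) : Prop :=
  ∀ (i : Fin k) (e : List ℕ), (child i).IsEdge e → (child i).markAt e ≠ none →
    line (i :: e) = ↑i :: subLine line i e

theorem markAt_line_iff (hline : LineCompatible k child line) (i : Fin k) {v e : List ℕ}
    (he : (child i).IsEdge e) (m : Option Mark) (hm : m ≠ none) :
    ((node k hk mark child).markAt (i :: e) = m ∧ line (i :: e) = ↑i :: v) ↔
      ((child i).markAt e = m ∧ subLine line i e = v) := by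
  rw [markAt_cons i he.1]
  refine and_congr_right fun h => ?_
  rw [hline i e he (h ▸ hm)]
  simp

theorem lineClosed_cons_iff (hline : LineCompatible k child line) {i : Fin k} {v : List ℕ}
    (hv : (child i).IsVertex v) :
    (node k hk mark child).LineClosed line (i :: v) ↔
      ((child i).LineClosed (subLine line i) v ∧
        TopFree mark (fun b => line [↑b]) (i :: v) (i + 1)) ∨
      ((child i).LineOpen (subLine line i) v ∧
        TopClosed mark (fun b => line [↑b]) (i :: v) (i + 1)) := by
  have hmark (b : Fin k) := markAt_singleton (hk := hk) (mark := mark) (child := child) b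
  have hin : ∀ e, (child i).Crosses v e → (node k hk mark child).Crosses (i :: v) (i :: e) :=
    fun e he => crosses_cons_iff.2 (Or.inr ⟨e, rfl, he⟩)
  have htop : ∀ b : Fin k, (i : ℕ) + 1 ≤ b → (node k hk mark child).Crosses (i :: v) [↑b] :=
    fun b hb => crosses_cons_iff.2 (Or.inl ⟨hv, b, hb, rfl⟩)
  constructor
  · rintro ⟨e, he, h1, h2, h3⟩
    obtain ⟨-, j, hj, rfl⟩ | ⟨e, rfl, hc⟩ := crosses_cons_iff.1 he
    · refine Or.inr ⟨fun e he => ?_, j, hj, by rwa [hmark] at h1, fun b hb hbj => ?_,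
        fun b hb => ?_⟩
      · exact (markAt_line_iff hline i he.2.1 _ (by simp)).1
          (h2 _ (hin e he) (by simp only [List.cons_lt_cons_iff]; exact Or.inl hj))
      · rw [← hmark]
        exact h2 _ (htop b hb) (by simp [List.cons_lt_cons_iff, hbj])
      · rw [← hmark]
        exact h3 _ (htop b (hj.trans hb)) (by simp [List.cons_lt_cons_iff, hb])
    · refine Or.inl ⟨⟨e, hc, (markAt_line_iff hline i hc.2.1 _ (by simp)).1 h1,
        fun e' he' hlt => ?_, fun e' he' hlt => ?_⟩, fun b hb => ?_⟩
      · exact (markAt_line_iff hline i he'.2.1 _ (by simp)).1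
          (h2 _ (hin e' he') (by simpa [List.cons_lt_cons_iff] using hlt))
      · rintro ⟨hm, hl⟩
        refine h3 _ (hin e' he') (by simpa [List.cons_lt_cons_iff] using hlt) ?_
        have := (markAt_line_iff (hk := hk) (mark := mark) hline i he'.2.1 _ hm).2 ⟨rfl, hl⟩
        exact ⟨this.1.symm ▸ hm, this.2⟩
      · rw [← hmark]
        refine h3 _ (htop b hb) ?_
        rw [List.cons_lt_cons_iff]
        exact Or.inl hb
  · rintro (⟨⟨e, he, h1, h2, h3⟩, hfree⟩ | ⟨hopen, j, hj, h1, h2, h3⟩)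
    · refine ⟨i :: e, hin e he, (markAt_line_iff hline i he.2.1 _ (by simp)).2 h1, ?_, ?_⟩
      · rintro e' he' hlt
        obtain ⟨-, b, hb, rfl⟩ | ⟨e', rfl, hc⟩ := crosses_cons_iff.1 he'
        · rw [List.cons_lt_cons_iff] at hlt
          have : (i : ℕ) < b := hb
          omega
        · exact (markAt_line_iff hline i hc.2.1 _ (by simp)).2
            (h2 _ hc (by simpa [List.cons_lt_cons_iff] using hlt))
      · rintro e' he' hlt ⟨hm, hl⟩
        obtain ⟨-, b, hb, rfl⟩ | ⟨e', rfl, hc⟩ := crosses_cons_iff.1 he'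
        · rw [hmark] at hm
          exact hfree b hb ⟨hm, hl⟩
        · have := (markAt_line_iff hline i hc.2.1 _ hm).1 ⟨rfl, hl⟩
          exact h3 e' hc (by simpa [List.cons_lt_cons_iff] using hlt)
            ⟨this.1.symm ▸ hm, this.2⟩
    · refine ⟨[↑j], htop j hj, by rwa [hmark], ?_, ?_⟩
      · rintro e' he' hlt
        obtain ⟨-, b, hb, rfl⟩ | ⟨e', rfl, hc⟩ := crosses_cons_iff.1 he'
        · rw [hmark]
          exact h2 b hb (by simpa [List.cons_lt_cons_iff] using hlt)
        · exact (markAt_line_iff hline i hc.2.1 _ (by simp)).2 (hopen _ hc)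
      · rintro e' he' hlt
        obtain ⟨-, b, hb, rfl⟩ | ⟨e', rfl, hc⟩ := crosses_cons_iff.1 he'
        · rw [hmark]
          exact h3 b (by simpa [List.cons_lt_cons_iff] using hlt)
        · rw [List.cons_lt_cons_iff] at hlt
          have := List.not_lt_nil e'
          have : (i : ℕ) < j := hj
          omega

theorem lineOpen_cons_iff (hline : LineCompatible k child line) {i : Fin k} {v : List ℕ}
    (hv : (child i).IsVertex v) :
    (node k hk mark child).LineOpen line (i :: v) ↔
      (child i).LineOpen (subLine line i) v ∧
        TopOpen mark (fun b => line [↑b]) (i :: v) (i + 1) := by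
  constructor
  · intro h
    refine ⟨fun e he => ?_, fun b hb => ?_⟩
    · exact (markAt_line_iff hline i he.2.1 _ (by simp)).1
        (h _ (crosses_cons_iff.2 (Or.inr ⟨e, rfl, he⟩)))
    · rw [← markAt_singleton (hk := hk) (mark := mark) (child := child)]
      exact h _ (crosses_cons_iff.2 (Or.inl ⟨hv, b, hb, rfl⟩))
  · rintro ⟨h1, h2⟩ e he
    obtain ⟨-, b, hb, rfl⟩ | ⟨e, rfl, hc⟩ := crosses_cons_iff.1 he
    · rw [markAt_singleton]
      exact h2 b hb
    · exact (markAt_line_iff hline i hc.2.1 _ (by simp)).2 (h1 _ hc)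

theorem linesValid_node_iff : (node k hk mark child).LinesValid line ↔
    LineCompatible k child line ∧ (∀ i : Fin k, (child i).LinesValid (subLine line i)) ∧
    ∀ b : Fin k, (mark b ≠ none → line [↑b] = [] ∨
      ∃ i < b, ∃ v, (child i).IsVertex v ∧ line [↑b] = ↑i :: v) ∧
      (child b ≠ leaf → mark b ≠ none) := by
  constructor
  · rintro ⟨h1, h2⟩
    have hcross : ∀ (i : Fin k) (e : List ℕ), (child i).IsEdge e → (child i).markAt e ≠ none →
        ∃ v, line (i :: e) = ↑i :: v ∧ (child i).Crosses v e := by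
      intro i e he hm
      have h3 := h1 (i :: e) (isEdge_node_iff.2 ⟨i, Or.inr ⟨e, rfl, he⟩⟩)
        (by rwa [markAt_cons i he.1])
      cases hl : line (i :: e) with
      | nil =>
        rw [hl] at h3
        obtain ⟨b, hb⟩ := crosses_nil_iff.1 h3
        simp only [List.cons.injEq] at hb
        exact absurd hb.2 he.1
      | cons j v =>
        rw [hl] at h3
        obtain ⟨b, rfl, -⟩ := isVertex_cons_iff.1 h3.1
        obtain ⟨-, c, -, hc⟩ | ⟨e', he', h4⟩ := crosses_cons_iff.1 h3
        · simp only [List.cons.injEq] at hc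
          exact absurd hc.2 he.1
        · simp only [List.cons.injEq] at he'
          obtain ⟨hib, rfl⟩ := he'
          obtain rfl := Fin.ext hib
          exact ⟨v, rfl, h4⟩
    refine ⟨fun i e he hm => ?_, fun i => ⟨fun e he hm => ?_, fun e he hv => ?_⟩,
      fun b => ⟨fun hm => ?_, fun hb => ?_⟩⟩
    · obtain ⟨v, h3, -⟩ := hcross i e he hm
      rw [subLine, h3, List.tail_cons]
    · obtain ⟨v, h3, h4⟩ := hcross i e he hm
      rwa [subLine, h3, List.tail_cons]
    · rw [← markAt_cons (hk := hk) (mark := mark) i he.1]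
      exact h2 _ (isEdge_node_iff.2 ⟨i, Or.inr ⟨e, rfl, he⟩⟩) (isVertex_cons.2 hv)
    · have h3 := h1 [↑b] (isEdge_node_iff.2 ⟨b, Or.inl rfl⟩) (by rwa [markAt_singleton])
      cases hl : line [↑b] with
      | nil => exact Or.inl rfl
      | cons j v =>
        rw [hl] at h3
        obtain ⟨i, rfl, hv⟩ := isVertex_cons_iff.1 h3.1
        obtain ⟨-, c, hic, hc⟩ | ⟨e', he', h4⟩ := crosses_cons_iff.1 h3
        · simp only [List.cons.injEq, and_true] at hc
          obtain rfl := Fin.ext hc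
          exact Or.inr ⟨i, hic, v, hv, rfl⟩
        · simp only [List.cons.injEq] at he'
          exact absurd he'.2.symm h4.2.1.1
    · rw [← markAt_singleton (hk := hk) (mark := mark) (child := child)]
      exact h2 _ (isEdge_node_iff.2 ⟨b, Or.inl rfl⟩) (isVertex_cons.2 (isVertex_nil_iff.2 hb))
  · rintro ⟨hline, h1, h2⟩
    constructor
    · intro e he hm
      obtain ⟨b, rfl | ⟨e, rfl, hc⟩⟩ := isEdge_node_iff.1 he
      · rw [markAt_singleton] at hm
        obtain h | ⟨i, hi, v, hv, h⟩ := (h2 b).1 hm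
        · rw [h]
          exact crosses_nil_iff.2 ⟨b, rfl⟩
        · rw [h]
          exact crosses_cons_iff.2 (Or.inl ⟨hv, b, hi, rfl⟩)
      · rw [markAt_cons b hc.1] at hm
        rw [hline b e hc hm]
        exact crosses_cons_iff.2 (Or.inr ⟨e, rfl, (h1 b).1 e hc hm⟩)
    · intro e he hv
      obtain ⟨b, rfl | ⟨e, rfl, hc⟩⟩ := isEdge_node_iff.1 he
      · rw [markAt_singleton]
        exact (h2 b).2 (isVertex_nil_iff.1 (isVertex_cons.1 hv))
      · rw [markAt_cons b hc.1]
        exact (h1 b).2 e hc (isVertex_cons.1 hv)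

end Top

end DecTree

namespace DecTree

theorem not_isKernelTree_both (S : DecTree) (h1 : IsKernelTree true S) :
    ¬ IsKernelTree false S := by
  induction S with
  | leaf => simp [IsKernelTree]
  | node k hk mark child ih =>
    simp only [IsKernelTree] at h1 ⊢
    intro h
    obtain ⟨j, -, hj, hq, -⟩ := h1
    obtain ⟨-, hp⟩ | ⟨hd, -⟩ := h j
    · exact ih j hq hp
    · rw [hj] at hd
      exact absurd hd (by decide)

section Forward

variable {k : ℕ} {hk : 2 ≤ k} {mark : Fin k → Option Mark} {child : Fin k → DecTree}
variable {owner : Fin k → List ℕ}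

theorem TopFree.mono {v : List ℕ} {s t : ℕ} (h : TopFree mark owner v s) (hst : s ≤ t) :
    TopFree mark owner v t := fun b hb => h b (hst.trans hb)

theorem owner_eq_of_top {v : List ℕ} {s : Fin k}
    (h : TopClosed mark owner v s ∨ TopOpen mark owner v s) : owner s = v := by
  obtain ⟨j, hj, h1, h2, -⟩ | h := h
  · obtain h | h := (show s ≤ j from hj).lt_or_eq
    · exact (h2 s le_rfl h).2
    · exact h ▸ h1.2
  · exact (h s le_rfl).2

/-- The shape of a tree, read off from what the lines do at the inputs of its root; `src i u`
means that the line of the vertex `u` of the `i`-th subtree leaves this subtree. -/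
theorem isKernelTree_of_top (src : Fin k → List ℕ → Prop)
    (hown : ∀ b, mark b ≠ none → owner b = [] ∨
      ∃ i < b, ∃ v, (child i).IsVertex v ∧ owner b = ↑i :: v)
    (hint : ∀ b, child b ≠ leaf → mark b ≠ none)
    (hroot : TopClosed mark owner [] 0 ∨ TopOpen mark owner [] 0)
    (hchild : ∀ i : Fin k,
      (IsKernelTree true (child i) ∧
        ∀ u, (child i).IsVertex u → TopFree mark owner (i :: u) (i + 1)) ∨
      (IsKernelTree false (child i) ∧ ∃ u, src i u ∧
        (TopClosed mark owner (i :: u) (i + 1) ∨ TopOpen mark owner (i :: u) (i + 1)) ∧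
        ∀ u', (child i).IsVertex u' → u' ≠ u → TopFree mark owner (i :: u') (i + 1)))
    (hnil : TopOpen mark owner [] 0 → ∀ (i : Fin k) (u : List ℕ), src i u →
      ¬ TopOpen mark owner (i :: u) (i + 1))
    (huniq : ∀ (i : Fin k) (u : List ℕ), src i u → TopOpen mark owner (i :: u) (i + 1) →
      ∀ (i' : Fin k) (u' : List ℕ), src i' u' → TopOpen mark owner (i' :: u') (i' + 1) → i = i') :
    IsKernelTree true (node k hk mark child) ∨
      (IsKernelTree false (node k hk mark child) ∧ (TopOpen mark owner [] 0 ∨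
        ∃ (i : Fin k) (u : List ℕ), src i u ∧ TopOpen mark owner (i :: u) (i + 1))) := by
  suffices key : ∀ (n s : ℕ) (v : List ℕ), k - s = n →
      (∀ b : Fin k, (b : ℕ) < s → (mark b = some Mark.circle ∧ IsKernelTree false (child b)) ∨
        (mark b = some Mark.dot ∧ IsKernelTree true (child b))) →
      (v ≠ [] → TopFree mark owner [] s) →
      (∀ i : Fin k, (i : ℕ) < s → ∀ u, (child i).IsVertex u → ↑i :: u ≠ v →
        TopFree mark owner (i :: u) s) →
      (TopClosed mark owner v s ∨ TopOpen mark owner v s) →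
      (v = [] ∧ s = 0 ∨ ∃ (i : Fin k) (u : List ℕ), src i u ∧ v = ↑i :: u ∧ s = i + 1) →
      IsKernelTree true (node k hk mark child) ∨
      (IsKernelTree false (node k hk mark child) ∧ (TopOpen mark owner [] 0 ∨
        ∃ (i : Fin k) (u : List ℕ), src i u ∧ TopOpen mark owner (i :: u) (i + 1))) from
    key k 0 [] rfl (fun b hb => absurd hb (Nat.not_lt_zero _)) (fun h => absurd rfl h)
      (fun b hb => absurd hb (Nat.not_lt_zero _)) hroot (Or.inl ⟨rfl, rfl⟩)
  intro n
  induction n using Nat.strong_induction_on with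
  | _ n ih =>
  intro s v hn h1 h2 h3 h4 h5
  have hne : ∀ (b : Fin k) (u : List ℕ), s ≤ b → ↑b :: u ≠ v := by
    rintro b u hb rfl
    obtain ⟨h, -⟩ | ⟨i, u', -, h, rfl⟩ := h5
    · simp at h
    · simp only [List.cons.injEq] at h
      omega
  have hdot : ∀ b : Fin k, s ≤ b → ∀ hb : (b : ℕ) + 1 < k, owner ⟨b + 1, hb⟩ = v →
      IsKernelTree true (child b) ∧
        ∀ u, (child b).IsVertex u → TopFree mark owner (b :: u) (b + 1) := by
    intro b hsb hb hv
    obtain h | ⟨-, u, -, h, -⟩ := hchild b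
    · exact h
    · have := owner_eq_of_top (s := ⟨b + 1, hb⟩) h
      exact absurd (this.symm.trans hv) (hne b u hsb)
  obtain ⟨j, hsj, hj, hlt, hgt⟩ | hopen := h4
  · have hbefore : ∀ b : Fin k, s ≤ b → b < j → IsKernelTree true (child b) ∧
        ∀ u, (child b).IsVertex u → TopFree mark owner (b :: u) (b + 1) := by
      intro b hsb hbj
      have hb : (b : ℕ) + 1 < k := lt_of_le_of_lt hbj j.2
      refine hdot b hsb hb ?_
      obtain h | h := (show (⟨b + 1, hb⟩ : Fin k) ≤ j from hbj).lt_or_eq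
      · exact (hlt _ (by simp only; omega) h).2
      · exact h ▸ hj.2
    have hpiece : ∀ b : Fin k, b < j →
        (mark b = some Mark.circle ∧ IsKernelTree false (child b)) ∨
        (mark b = some Mark.dot ∧ IsKernelTree true (child b)) := by
      intro b hbj
      by_cases hsb : s ≤ b
      · exact Or.inr ⟨(hlt b hsb hbj).1, (hbefore b hsb hbj).1⟩
      · exact h1 b (not_le.1 hsb)
    have hfree : ∀ i : Fin k, i < j → ∀ u, (child i).IsVertex u →
        TopFree mark owner (i :: u) (j + 1) := by
      intro i hij u hu
      by_cases hv : ↑i :: u = v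
      · rw [hv]
        exact fun b hb => hgt b hb
      · by_cases hsi : s ≤ i
        · exact ((hbefore i hsi hij).2 u hu).mono (Nat.succ_le_succ hij.le)
        · exact (h3 i (not_le.1 hsi) u hu hv).mono (by omega)
    have hfree_nil : TopFree mark owner [] (j + 1) := by
      by_cases hv : v = []
      · rw [hv] at hgt
        exact fun b hb => hgt b hb
      · exact (h2 hv).mono (by omega)
    obtain ⟨hq, hqf⟩ | ⟨hp, u, hu, htop, huf⟩ := hchild j
    · left
      simp only [IsKernelTree]
      refine ⟨j, hpiece, hj.1, hq, ?_⟩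
      intro b
      induction b using WellFoundedLT.induction with
      | ind b ihb =>
      intro hjb
      have hnone : mark b = none := by
        by_contra hm
        obtain h | ⟨i, hib, u, hu, h⟩ := hown b hm
        · exact hfree_nil b hjb ⟨hm, h⟩
        · rcases lt_trichotomy i j with hij | rfl | hij
          · exact hfree i hij u hu b hjb ⟨hm, h⟩
          · exact hqf u hu b hjb ⟨hm, h⟩
          · rw [(ihb i hib hij).2] at hu
            exact not_isVertex_leaf u hu
      refine ⟨hnone, ?_⟩
      by_contra hb
      exact hint b hb hnone
    · refine ih (k - (j + 1)) (by omega) (j + 1) (j :: u) rfl ?_ (fun _ => hfree_nil) ?_ htop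
        (Or.inr ⟨j, u, hu, rfl, rfl⟩)
      · intro b hb
        obtain h | rfl := (show b ≤ j from Nat.lt_succ_iff.1 hb).lt_or_eq
        · exact hpiece b h
        · exact Or.inl ⟨hj.1, hp⟩
      · intro i hi u' hu' hne'
        obtain h | rfl := (show i ≤ j from Nat.lt_succ_iff.1 hi).lt_or_eq
        · exact hfree i h u' hu'
        · exact huf u' hu' fun h => hne' (by rw [h])
  · right
    constructor
    · simp only [IsKernelTree]
      intro b
      by_cases hsb : s ≤ b
      · refine Or.inr ⟨(hopen b hsb).1, ?_⟩
        by_cases hb : (b : ℕ) + 1 < k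
        · exact (hdot b hsb hb (hopen _ (by simp only; omega)).2).1
        · obtain h | ⟨-, u, hu, -, -⟩ := hchild b
          · exact h.1
          · have htop : TopOpen mark owner (b :: u) (b + 1) := fun c hc => by omega
            obtain ⟨rfl, rfl⟩ | ⟨i, u', hu', rfl, rfl⟩ := h5
            · exact absurd htop (hnil hopen b u hu)
            · have := huniq i u' hu' hopen b u hu htop
              subst this
              omega
      · exact h1 b (not_le.1 hsb)
    · obtain ⟨rfl, rfl⟩ | ⟨i, u', hu', rfl, rfl⟩ := h5
      · exact Or.inl hopen
      · exact Or.inr ⟨i, u', hu', hopen⟩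

end Forward

theorem isKernelTree_of_lines (S : DecTree) (line : List ℕ → List ℕ) (hvalid : S.LinesValid line)
    (hline : ∀ v, S.IsVertex v → S.LineClosed line v ∨ S.LineOpen line v)
    (huniq : ∀ v w, S.IsVertex v → S.IsVertex w → S.LineOpen line v → S.LineOpen line w → v = w) :
    (IsKernelTree true S ∧ ∀ v, S.IsVertex v → ¬ S.LineOpen line v) ∨
      (IsKernelTree false S ∧ ∃ v, S.IsVertex v ∧ S.LineOpen line v) := by
  induction S generalizing line with
  | leaf => exact Or.inl ⟨by simp [IsKernelTree], fun v hv => absurd hv (not_isVertex_leaf v)⟩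
  | node k hk mark child ih =>
    obtain ⟨hcomp, hvalid', htop⟩ := linesValid_node_iff.1 hvalid
    have hcl : ∀ (i : Fin k) (v : List ℕ), (child i).IsVertex v →
        ((child i).LineClosed (subLine line i) v ∧
          TopFree mark (fun b => line [↑b]) (i :: v) (i + 1)) ∨
        ((child i).LineOpen (subLine line i) v ∧
          (TopClosed mark (fun b => line [↑b]) (i :: v) (i + 1) ∨
            TopOpen mark (fun b => line [↑b]) (i :: v) (i + 1))) := by
      intro i v hv
      obtain h | h := hline (i :: v) (isVertex_cons.2 hv)
      · obtain h | h := (lineClosed_cons_iff hcomp hv).1 h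
        · exact Or.inl h
        · exact Or.inr ⟨h.1, Or.inl h.2⟩
      · have := (lineOpen_cons_iff hcomp hv).1 h
        exact Or.inr ⟨this.1, Or.inr this.2⟩
    have hopen_top : ∀ (i : Fin k) (v : List ℕ), (child i).IsVertex v →
        (child i).LineOpen (subLine line i) v →
          TopClosed mark (fun b => line [↑b]) (i :: v) (i + 1) ∨
            TopOpen mark (fun b => line [↑b]) (i :: v) (i + 1) := by
      intro i v hv ho
      obtain h | h := hcl i v hv
      · exact absurd ho h.1.not_lineOpen
      · exact h.2
    have hchild := fun i => ih i (subLine line i) (hvalid' i)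
      (fun v hv => (hcl i v hv).imp And.left And.left) (by
        intro v w hv hw hov how
        have h1 := hopen_top i v hv hov
        have h2 := hopen_top i w hw how
        by_cases hi : (i : ℕ) + 1 < k
        · have e1 := owner_eq_of_top (s := ⟨i + 1, hi⟩) h1
          have e2 := owner_eq_of_top (s := ⟨i + 1, hi⟩) h2
          simpa using e1.symm.trans e2
        · have hall : ∀ u, TopOpen mark (fun b => line [↑b]) (i :: u) (i + 1) :=
            fun u b hb => by omega
          simpa using huniq _ _ (isVertex_cons.2 hv) (isVertex_cons.2 hw)
            ((lineOpen_cons_iff hcomp hv).2 ⟨hov, hall v⟩)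
            ((lineOpen_cons_iff hcomp hw).2 ⟨how, hall w⟩))
    have hnil : (node k hk mark child).IsVertex [] := isVertex_nil_iff.2 (by simp)
    have hmain := isKernelTree_of_top (hk := hk) (mark := mark) (child := child)
      (owner := fun b => line [↑b])
      (fun i u => (child i).IsVertex u ∧ (child i).LineOpen (subLine line i) u)
      (fun b => (htop b).1) (fun b => (htop b).2)
      ((hline [] hnil).imp lineClosed_nil_iff.1 lineOpen_nil_iff.1)
      (by
        intro i
        refine (hchild i).imp (fun h => ⟨h.1, fun u hu => ?_⟩) fun ⟨h, u, hu, ho⟩ =>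
          ⟨h, u, ⟨hu, ho⟩, hopen_top i u hu ho, fun u' hu' hne => ?_⟩
        · obtain h' | h' := hcl i u hu
          · exact h'.2
          · exact absurd h'.1 (h.2 u hu)
        · obtain h' | h' := hcl i u' hu'
          · exact h'.2
          · refine absurd ?_ hne
            by_cases hi : (i : ℕ) + 1 < k
            · have e1 := owner_eq_of_top (s := ⟨i + 1, hi⟩) h'.2
              have e2 := owner_eq_of_top (s := ⟨i + 1, hi⟩) (hopen_top i u hu ho)
              simpa using e1.symm.trans e2
            · have hall : ∀ u, TopOpen mark (fun b => line [↑b]) (i :: u) (i + 1) :=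
                fun u b hb => by omega
              simpa using huniq _ _ (isVertex_cons.2 hu') (isVertex_cons.2 hu)
                ((lineOpen_cons_iff hcomp hu').2 ⟨h'.1, hall u'⟩)
                ((lineOpen_cons_iff hcomp hu).2 ⟨ho, hall u⟩))
      (by
        intro h i u hu hou
        simpa using huniq _ _ hnil (isVertex_cons.2 hu.1) (lineOpen_nil_iff.2 h)
          ((lineOpen_cons_iff hcomp hu.1).2 ⟨hu.2, hou⟩))
      (by
        intro i u hu h i' u' hu' h'
        have := huniq _ _ (isVertex_cons.2 hu.1) (isVertex_cons.2 hu'.1)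
          ((lineOpen_cons_iff hcomp hu.1).2 ⟨hu.2, h⟩)
          ((lineOpen_cons_iff hcomp hu'.1).2 ⟨hu'.2, h'⟩)
        simp only [List.cons.injEq] at this
        exact Fin.ext this.1)
    refine hmain.imp (fun hq => ⟨hq, ?_⟩) fun ⟨hp, h⟩ => ⟨hp, ?_⟩
    · simp only [IsKernelTree] at hq
      obtain ⟨j, -, hj, hqj, hgt⟩ := hq
      intro v hv ho
      cases v with
      | nil =>
        have := (lineOpen_nil_iff.1 ho j (Nat.zero_le _)).1
        rw [hj] at this
        exact absurd this (by decide)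
      | cons i v =>
        obtain ⟨i, rfl, hv'⟩ := isVertex_cons_iff.1 hv
        have ho' := (lineOpen_cons_iff hcomp hv').1 ho
        rcases lt_trichotomy i j with hij | rfl | hij
        · have := (ho'.2 j hij).1
          rw [hj] at this
          exact absurd this (by decide)
        · obtain h | h := hchild i
          · exact h.2 v hv' ho'.1
          · exact not_isKernelTree_both _ hqj h.1
        · rw [(hgt i hij).2] at hv'
          exact not_isVertex_leaf v hv'
    · obtain h | ⟨i, u, hu, h⟩ := h
      · exact ⟨[], hnil, lineOpen_nil_iff.2 h⟩
      · exact ⟨_, isVertex_cons.2 hu.1, (lineOpen_cons_iff hcomp hu.1).2 ⟨hu.2, h⟩⟩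

section Backward

theorem LineClosed.congr {S : DecTree} {line line' : List ℕ → List ℕ}
    (h : ∀ e, e ≠ [] → line e = line' e) {v : List ℕ} (hv : S.LineClosed line v) :
    S.LineClosed line' v := by
  obtain ⟨e, he, h1, h2, h3⟩ := hv
  refine ⟨e, he, by rwa [← h e he.2.1.1], fun e' he' hlt => ?_, fun e' he' hlt => ?_⟩
  · rw [← h e' he'.2.1.1]
    exact h2 e' he' hlt
  · rw [← h e' he'.2.1.1]
    exact h3 e' he' hlt

theorem LineOpen.congr {S : DecTree} {line line' : List ℕ → List ℕ}
    (h : ∀ e, e ≠ [] → line e = line' e) {v : List ℕ} (hv : S.LineOpen line v) :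
    S.LineOpen line' v := by
  intro e he
  rw [← h e he.2.1.1]
  exact hv e he

theorem LinesValid.congr {S : DecTree} {line line' : List ℕ → List ℕ}
    (h : ∀ e, e ≠ [] → line e = line' e) (hS : S.LinesValid line) : S.LinesValid line' := by
  refine ⟨fun e he hm => ?_, hS.2⟩
  rw [← h e he.1]
  exact hS.1 e he hm

/-- The lines of a tree with prescribed lines in the subtrees at the root. -/
def glueLines {k : ℕ} (owner : ℕ → List ℕ) (l : Fin k → List ℕ → List ℕ) : List ℕ → List ℕ
  | [] => []
  | [j] => owner j
  | i :: j :: e => if hi : i < k then i :: l ⟨i, hi⟩ (j :: e) else []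

variable {k : ℕ} {hk : 2 ≤ k} {mark : Fin k → Option Mark} {child : Fin k → DecTree}

/-- Lines in a tree whose first `J` subtrees are of the kind that may occur to the left. -/
theorem exists_lines_node (J : ℕ)
    (hlt : ∀ b : Fin k, (b : ℕ) < J → mark b = some Mark.circle ∨ mark b = some Mark.dot)
    (hJ : ∀ b : Fin k, (b : ℕ) = J → mark b = some Mark.circle)
    (hgt : ∀ b : Fin k, J < (b : ℕ) → mark b = none ∧ child b = leaf)
    (l : Fin k → List ℕ → List ℕ) (w : Fin k → List ℕ)
    (hl : ∀ i, (child i).LinesValid (l i))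
    (hopen : ∀ i : Fin k, (i : ℕ) < J → mark i = some Mark.circle →
      (child i).IsVertex (w i) ∧ (child i).LineOpen (l i) (w i))
    (hclosed : ∀ (i : Fin k) (v : List ℕ), (child i).IsVertex v →
      ¬ ((i : ℕ) < J ∧ mark i = some Mark.circle ∧ v = w i) → (child i).LineClosed (l i) v) :
    ∃ (line : List ℕ → List ℕ) (v : List ℕ), (node k hk mark child).LinesValid line ∧
      (k ≤ J → (node k hk mark child).IsVertex v ∧ (node k hk mark child).LineOpen line v) ∧
      ∀ u, (node k hk mark child).IsVertex u → ¬ (k ≤ J ∧ u = v) →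
        (node k hk mark child).LineClosed line u := by
  classical
  obtain ⟨src, hsrc⟩ : ∃ src : Fin k → Prop,
      ∀ b, src b ↔ ((b : ℕ) < J ∧ mark b = some Mark.circle) := ⟨_, fun _ => Iff.rfl⟩
  have howner : ∀ j : ℕ, ∃ o : List ℕ, (o = [] ∧ ∀ b : Fin k, (b : ℕ) < j → ¬ src b) ∨
      ∃ b : Fin k, (b : ℕ) < j ∧ src b ∧ o = ↑b :: w b ∧
        ∀ c : Fin k, b < c → (c : ℕ) < j → ¬ src c := by
    intro j
    by_cases h : ∃ b : Fin k, (b : ℕ) < j ∧ src b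
    · have hne : (Finset.univ.filter fun b : Fin k => (b : ℕ) < j ∧ src b).Nonempty := by
        obtain ⟨b, hb⟩ := h
        exact ⟨b, by simpa using hb⟩
      obtain ⟨b, hb, hmax⟩ := Finset.exists_max_image _ id hne
      simp only [Finset.mem_filter, Finset.mem_univ, true_and, id] at hb hmax
      exact ⟨↑b :: w b, Or.inr ⟨b, hb.1, hb.2, rfl, fun c hbc hc hs =>
        absurd (hmax c ⟨hc, hs⟩) (not_le.2 hbc)⟩⟩
    · push Not at h
      exact ⟨[], Or.inl ⟨rfl, h⟩⟩
  choose owner howner using howner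
  have hmark_src : ∀ b : Fin k, (b : ℕ) < J → ¬ src b → mark b = some Mark.dot := by
    intro b hb hs
    exact (hlt b hb).resolve_left fun h => hs ((hsrc b).2 ⟨hb, h⟩)
  set line := glueLines owner l with hline
  have htop : (fun b : Fin k => line [↑b]) = fun b : Fin k => owner b := rfl
  have hsub : ∀ (i : Fin k) (e : List ℕ), e ≠ [] → l i e = subLine line i e := by
    intro i e he
    obtain ⟨j, a, rfl⟩ := List.exists_cons_of_ne_nil he
    simp [hline, subLine, glueLines]
  have hcomp : LineCompatible k child line := by
    intro i e he _
    obtain ⟨j, a, rfl⟩ := List.exists_cons_of_ne_nil he.1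
    simp [hline, subLine, glueLines]
  have hvalid : (node k hk mark child).LinesValid line := by
    refine linesValid_node_iff.2 ⟨hcomp, fun i => (hl i).congr (hsub i), fun b => ⟨fun _ => ?_, ?_⟩⟩
    · change owner b = [] ∨ _
      obtain ⟨h, -⟩ | ⟨i, hi, hs, h, -⟩ := howner b
      · exact Or.inl h
      · exact Or.inr ⟨i, hi, w i, (hopen i ((hsrc i).1 hs).1 ((hsrc i).1 hs).2).1, h⟩
    · intro hb hm
      rcases lt_trichotomy (b : ℕ) J with h | h | h
      · rcases hlt b h with h' | h' <;> simp [h'] at hm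
      · simp [hJ b h] at hm
      · exact hb (hgt b h).2
  -- The line of a vertex that leaves the subtrees before the input `s`.
  have hclosed_top : ∀ (s : ℕ) (v : List ℕ),
      (∀ j, s ≤ j → (∀ c : Fin k, s ≤ c → (c : ℕ) < j → ¬ src c) → owner j = v) →
      (∀ j, (∃ c : Fin k, s ≤ c ∧ (c : ℕ) < j ∧ src c) → owner j ≠ v) →
      (∃ j : Fin k, s ≤ j ∧ mark j = some Mark.circle) →
      TopClosed mark (fun b : Fin k => line [↑b]) v s := by
    rintro s v hv1 hv2 hex
    have hne : (Finset.univ.filter fun b : Fin k => s ≤ b ∧ mark b = some Mark.circle).Nonempty := by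
      obtain ⟨b, hb⟩ := hex
      exact ⟨b, by simpa using hb⟩
    obtain ⟨j, hj, hmin⟩ := Finset.exists_min_image _ id hne
    simp only [Finset.mem_filter, Finset.mem_univ, true_and, id] at hj hmin
    have hnsrc : ∀ c : Fin k, s ≤ c → c < j → ¬ src c := fun c hsc hcj hs =>
      absurd (hmin c ⟨hsc, ((hsrc c).1 hs).2⟩) (not_le.2 hcj)
    have hjJ : (j : ℕ) ≤ J := by
      by_contra h
      have := (hgt j (not_le.1 h)).1
      rw [hj.2] at this
      exact absurd this (by simp)
    refine ⟨j, hj.1, ⟨hj.2, hv1 j hj.1 hnsrc⟩, fun b hsb hbj => ⟨?_, ?_⟩, ?_⟩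
    · exact hmark_src b (lt_of_lt_of_le hbj hjJ) (hnsrc b hsb hbj)
    · exact hv1 b hsb fun c hsc hcb => hnsrc c hsc (lt_trans hcb hbj)
    · rintro b hjb ⟨hm, ho⟩
      obtain h | h := hjJ.lt_or_eq
      · exact hv2 b ⟨j, hj.1, hjb, (hsrc j).2 ⟨h, hj.2⟩⟩ ho
      · exact hm (hgt b (h ▸ hjb)).1
  have hopen_top : ∀ (s : ℕ) (v : List ℕ),
      (∀ j, s ≤ j → (∀ c : Fin k, s ≤ c → (c : ℕ) < j → ¬ src c) → owner j = v) →
      k ≤ J → (∀ c : Fin k, s ≤ c → ¬ src c) →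
      TopOpen mark (fun b : Fin k => line [↑b]) v s := by
    intro s v hv1 hkJ hs b hb
    exact ⟨hmark_src b (lt_of_lt_of_le b.2 hkJ) (hs b hb), hv1 b hb fun c hc _ => hs c hc⟩
  have hnil1 : ∀ j, 0 ≤ j → (∀ c : Fin k, 0 ≤ (c : ℕ) → (c : ℕ) < j → ¬ src c) →
      owner j = [] := by
    intro j _ hj
    obtain ⟨h, -⟩ | ⟨b, hb, hs, -⟩ := howner j
    · exact h
    · exact absurd hs (hj b (Nat.zero_le _) hb)
  have hnil2 : ∀ j, (∃ c : Fin k, 0 ≤ (c : ℕ) ∧ (c : ℕ) < j ∧ src c) → owner j ≠ [] := by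
    rintro j ⟨c, -, hc, hs⟩ h
    obtain ⟨-, h'⟩ | ⟨b, hb, -, h', -⟩ := howner j
    · exact h' c hc hs
    · rw [h'] at h
      exact absurd h (by simp)
  have hcons1 : ∀ i : Fin k, src i → ∀ j, (i : ℕ) + 1 ≤ j →
      (∀ c : Fin k, (i : ℕ) + 1 ≤ c → (c : ℕ) < j → ¬ src c) → owner j = ↑i :: w i := by
    intro i hi j hij hj
    obtain ⟨-, h⟩ | ⟨b, hb, hs, h, h'⟩ := howner j
    · exact absurd hi (h i hij)
    · rcases lt_trichotomy i b with hib | rfl | hib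
      · exact absurd hs (hj b hib hb)
      · exact h
      · exact absurd hi (h' i hib hij)
  have hcons2 : ∀ i : Fin k, ∀ j, (∃ c : Fin k, (i : ℕ) + 1 ≤ c ∧ (c : ℕ) < j ∧ src c) →
      owner j ≠ ↑i :: w i := by
    rintro i j ⟨c, hic, hc, hs⟩ h
    obtain ⟨-, h'⟩ | ⟨b, hb, hsb, h', h''⟩ := howner j
    · exact h' c hc hs
    · rw [h', List.cons.injEq] at h
      obtain rfl := Fin.ext h.1
      exact h'' c hic hc hs
  have hex : ∀ s : ℕ, s ≤ J → (¬ k ≤ J ∨ ∃ c : Fin k, s ≤ c ∧ src c) →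
      ∃ j : Fin k, s ≤ j ∧ mark j = some Mark.circle := by
    rintro s hs (h | ⟨c, hc, hsc⟩)
    · exact ⟨⟨J, not_le.1 h⟩, hs, hJ _ rfl⟩
    · exact ⟨c, hc, ((hsrc c).1 hsc).2⟩
  refine ⟨line, owner k, hvalid, fun hkJ => ?_, fun u hu hne => ?_⟩
  · obtain ⟨h, hs⟩ | ⟨i, hi, hs, h, hs'⟩ := howner k
    · rw [h]
      exact ⟨isVertex_nil_iff.2 (by simp),
        lineOpen_nil_iff.2 (hopen_top 0 [] hnil1 hkJ fun c _ => hs c c.2)⟩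
    · rw [h]
      have ho := hopen i ((hsrc i).1 hs).1 ((hsrc i).1 hs).2
      exact ⟨isVertex_cons.2 ho.1, (lineOpen_cons_iff hcomp ho.1).2 ⟨ho.2.congr (hsub i),
        hopen_top _ _ (hcons1 i hs) hkJ fun c hc => hs' c hc c.2⟩⟩
  · cases u with
    | nil =>
      refine lineClosed_nil_iff.2 (hclosed_top 0 [] hnil1 hnil2 (hex 0 (Nat.zero_le _) ?_))
      by_contra h
      push Not at h
      exact hne ⟨h.1, (hnil1 k (Nat.zero_le _) fun c hc _ => h.2 c hc).symm⟩
    | cons i u =>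
      obtain ⟨i, rfl, hu'⟩ := isVertex_cons_iff.1 hu
      by_cases hsi : src i ∧ u = w i
      · obtain ⟨hs, rfl⟩ := hsi
        have ho := hopen i ((hsrc i).1 hs).1 ((hsrc i).1 hs).2
        refine (lineClosed_cons_iff hcomp hu').2 (Or.inr ⟨ho.2.congr (hsub i),
          hclosed_top _ _ (hcons1 i hs) (hcons2 i) (hex _ ((hsrc i).1 hs).1 ?_)⟩)
        by_contra h
        push Not at h
        exact hne ⟨h.1, (hcons1 i hs k i.2 fun c hc _ => h.2 c hc).symm⟩
      · refine (lineClosed_cons_iff hcomp hu').2 (Or.inl ⟨(hclosed i u hu' ?_).congr (hsub i), ?_⟩)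
        · rintro ⟨h1, h2, h3⟩
          exact hsi ⟨(hsrc i).2 ⟨h1, h2⟩, h3⟩
        · rintro b - ⟨-, ho⟩
          have ho : owner b = ↑i :: u := ho
          obtain ⟨h, -⟩ | ⟨c, -, hs, h, -⟩ := howner b
          · rw [h] at ho
            exact absurd ho (by simp)
          · rw [h, List.cons.injEq] at ho
            obtain rfl := Fin.ext ho.1
            exact hsi ⟨hs, ho.2.symm⟩

theorem exists_lines (S : DecTree) :
    (IsKernelTree true S →
      ∃ line, S.LinesValid line ∧ ∀ v, S.IsVertex v → S.LineClosed line v) ∧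
    (IsKernelTree false S → ∃ line w, S.LinesValid line ∧ (S.IsVertex w ∧ S.LineOpen line w) ∧
      ∀ v, S.IsVertex v → v ≠ w → S.LineClosed line v) := by
  induction S with
  | leaf =>
    refine ⟨fun _ => ⟨id, ⟨fun e he => ?_, fun e he hv => ?_⟩, fun v hv => ?_⟩, fun h => ?_⟩
    · obtain ⟨j, a, rfl⟩ := List.exists_cons_of_ne_nil he.1
      simp [IsEdge, subtree?] at he
    · exact absurd hv (not_isVertex_leaf e)
    · exact absurd hv (not_isVertex_leaf v)
    · simp [IsKernelTree] at h
  | node k hk mark child ih =>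
    have hdata : ∀ J : ℕ, (∀ b : Fin k, (b : ℕ) < J →
        (mark b = some Mark.circle ∧ IsKernelTree false (child b)) ∨
        (mark b = some Mark.dot ∧ IsKernelTree true (child b))) →
        (∀ b : Fin k, J ≤ (b : ℕ) → IsKernelTree true (child b)) →
        ∀ i : Fin k, ∃ l w, (child i).LinesValid l ∧
          ((i : ℕ) < J → mark i = some Mark.circle →
            (child i).IsVertex w ∧ (child i).LineOpen l w) ∧
          ∀ v, (child i).IsVertex v →
            ¬ ((i : ℕ) < J ∧ mark i = some Mark.circle ∧ v = w) → (child i).LineClosed l v := by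
      intro J h1 h2 i
      by_cases hi : (i : ℕ) < J ∧ mark i = some Mark.circle
      · obtain ⟨-, hp⟩ | ⟨hd, -⟩ := h1 i hi.1
        · obtain ⟨l, w, hl, hw, hv⟩ := (ih i).2 hp
          exact ⟨l, w, hl, fun _ _ => hw, fun v hv' hne => hv v hv' fun h => hne ⟨hi.1, hi.2, h⟩⟩
        · rw [hi.2] at hd
          exact absurd hd (by decide)
      · have hq : IsKernelTree true (child i) := by
          by_cases hiJ : (i : ℕ) < J
          · exact ((h1 i hiJ).resolve_left fun h => hi ⟨hiJ, h.1⟩).2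
          · exact h2 i (not_lt.1 hiJ)
        obtain ⟨l, hl, hv⟩ := (ih i).1 hq
        exact ⟨l, [], hl, fun h1 h2 => absurd ⟨h1, h2⟩ hi, fun v hv' _ => hv v hv'⟩
    constructor
    · intro h
      simp only [IsKernelTree] at h
      obtain ⟨j, h1, hj, hq, hgt⟩ := h
      have hge : ∀ b : Fin k, (j : ℕ) ≤ (b : ℕ) → IsKernelTree true (child b) := by
        intro b hb
        obtain h | rfl := (show j ≤ b from hb).lt_or_eq
        · rw [(hgt b h).2]
          simp [IsKernelTree]
        · exact hq
      choose l w hl ho hc using hdata j h1 hge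
      obtain ⟨line, v, hvalid, -, hcl⟩ := exists_lines_node (hk := hk) (j : ℕ)
        (fun b hb => (h1 b hb).imp And.left And.left)
        (fun b hb => by rw [Fin.ext hb]; exact hj) (fun b hb => hgt b hb) l w hl ho hc
      exact ⟨line, hvalid, fun u hu => hcl u hu fun h => by omega⟩
    · intro h
      simp only [IsKernelTree] at h
      choose l w hl ho hc using hdata k (fun b _ => h b) fun b hb => absurd b.2 (not_lt.2 hb)
      obtain ⟨line, v, hvalid, hop, hcl⟩ := exists_lines_node (hk := hk) k
        (fun b _ => (h b).imp And.left And.left) (fun b hb => absurd b.2 (not_lt.2 hb.ge))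
        (fun b hb => absurd b.2 (not_lt.2 hb.le)) l w hl ho hc
      exact ⟨line, v, hvalid, hop le_rfl, fun u hu hne => hcl u hu fun h => hne h.2⟩

end Backward

/-- The carp rules in recursive form. -/
theorem isCarp_iff_isKernelTree {S : DecTree} : S.IsCarp ↔ IsKernelTree true S := by
  rw [isCarp_iff]
  refine ⟨fun ⟨line, hvalid, hcl⟩ => ?_, (exists_lines S).1⟩
  obtain h | ⟨-, v, hv, ho⟩ := isKernelTree_of_lines S line hvalid (fun v hv => Or.inl (hcl v hv))
    fun v _ hv _ ho _ => absurd ho (hcl v hv).not_lineOpen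
  · exact h.1
  · exact absurd ho (hcl v hv).not_lineOpen

end DecTree

/-! ### Decomposition of grafted trees -/

theorem flatMap_blocks {X : Type*} {k : ℕ} (L : Fin k → ℕ) (g : ℕ → X) :
    ((List.finRange k).flatMap fun b => (List.range (L b)).map fun j => g (blockStart L b + j)) =
      (List.range (∑ b, L b)).map g := by
  induction k with
  | zero => simp
  | succ k ih =>
    have h1 : ∀ b : Fin k, blockStart L b.castSucc = blockStart (fun b => L b.castSucc) b := by
      intro b
      rw [blockStart, blockStart, ← Fin.map_castSuccEmb_Iio, Finset.sum_map]
      rfl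
    have h2 : blockStart L (Fin.last k) = ∑ b : Fin k, L b.castSucc := by
      have h3 : Finset.Iio (Fin.last k) = Finset.univ.map Fin.castSuccEmb := by
        ext a
        simp only [Finset.mem_Iio, Finset.mem_map, Finset.mem_univ, true_and]
        exact ⟨fun h => ⟨a.castLT h, rfl⟩, by rintro ⟨b, rfl⟩; exact b.castSucc_lt_last⟩
      rw [blockStart, h3, Finset.sum_map]
      rfl
    rw [List.finRange_succ_last, List.flatMap_append, List.flatMap_map, Fin.sum_univ_castSucc,
      List.range_add, List.map_append, List.map_map, ← ih]
    simp only [h1, h2, List.flatMap_cons, List.flatMap_nil, List.append_nil]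
    rfl

/-- The decorations of the leaf edges when all of them carry dots. -/
def dotMarks : ℕ → Option Mark := fun _ => some Mark.dot

/-- The decorations of the leaf edges of the p-kernel tree at the root of a decorated tree. -/
def topMarks (i : ℕ) : ℕ → Option Mark := fun α =>
  if α < i then some Mark.dot else if α = i then some Mark.circle else none

theorem topMarks_of_lt {i α : ℕ} (h : α < i) : topMarks i α = some Mark.dot := if_pos h

theorem topMarks_self (i : ℕ) : topMarks i i = some Mark.circle := by simp [topMarks]

theorem topMarks_of_gt {i α : ℕ} (h : i < α) : topMarks i α = none := by
  simp [topMarks, h.not_gt, h.ne']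

theorem topMarks_ne_none_iff {i α : ℕ} : topMarks i α ≠ none ↔ α ≤ i := by
  rcases lt_trichotomy α i with h | rfl | h
  · simp [topMarks_of_lt h, h.le]
  · simp [topMarks_self]
  · simp [topMarks_of_gt h, h]

namespace DecTree

/-- A decorated edge with the subtree below it, as in `h p_r (gf q ⊗ ⋯)` or `gf q`. -/
def IsPiece (m : Option Mark) (S : DecTree) : Prop :=
  (m = some Mark.circle ∧ IsKernelTree false S) ∨ (m = some Mark.dot ∧ IsKernelTree true S)

theorem leaves_pos (S : DecTree) : 0 < S.leaves := by
  induction S with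
  | leaf => simp [leaves]
  | node k hk mark child ih =>
    have : ∑ b : Fin k, 1 ≤ ∑ b, (child b).leaves := Finset.sum_le_sum fun b _ => ih b
    simp only [Finset.sum_const, Finset.card_univ, Fintype.card_fin, smul_eq_mul] at this
    simp only [leaves]
    omega

theorem eq_leaf_of_leaves_eq_one {S : DecTree} (hS : S.leaves = 1) : S = leaf := by
  cases S with
  | leaf => rfl
  | node k hk mark child =>
    have : ∑ b : Fin k, 1 ≤ ∑ b, (child b).leaves :=
      Finset.sum_le_sum fun b _ => leaves_pos (child b)
    simp only [Finset.sum_const, Finset.card_univ, Fintype.card_fin, smul_eq_mul] at this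
    simp only [leaves] at hS
    omega

theorem degree_of_isKernelTree (S : DecTree) :
    (IsKernelTree true S → S.degree = (S.leaves : ℤ) - 1) ∧
      (IsKernelTree false S → S.degree = (S.leaves : ℤ) - 2) := by
  induction S with
  | leaf => simp [IsKernelTree, degree, leaves]
  | node k hk mark child ih =>
    have hpiece : ∀ b, IsPiece (mark b) (child b) →
        markDegree (mark b) + (child b).degree = ((child b).leaves : ℤ) - 1 := by
      rintro b (⟨h1, h2⟩ | ⟨h1, h2⟩)
      · rw [h1, (ih b).2 h2, markDegree]
        ring
      · rw [h1, (ih b).1 h2]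
        simp [markDegree]
    constructor
    · intro h
      simp only [IsKernelTree] at h
      obtain ⟨j, h1, h2, h3, h4⟩ := h
      have : ∀ b, markDegree (mark b) + (child b).degree =
          (((child b).leaves : ℤ) - 1) + if b = j then 1 else 0 := by
        intro b
        rcases lt_trichotomy b j with hb | rfl | hb
        · rw [hpiece b (h1 b hb), if_neg hb.ne, add_zero]
        · rw [h2, (ih b).1 h3, markDegree, if_pos rfl]
          ring
        · rw [(h4 b hb).1, (h4 b hb).2, if_neg hb.ne']
          simp [markDegree, degree, leaves]
      simp only [degree, this, leaves, Finset.sum_add_distrib, Finset.sum_sub_distrib,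
        Finset.sum_ite_eq', Finset.mem_univ, if_true]
      push_cast
      simp
      ring
    · intro h
      simp only [IsKernelTree] at h
      simp only [degree, fun b => hpiece b (h b), leaves, Finset.sum_sub_distrib]
      push_cast
      simp

end DecTree

namespace PTree

open DecTree

theorem isPiece_graft (T : PTree) (S : ℕ → DecTree) (hS : ∀ α, IsKernelTree true (S α)) :
    IsPiece (T.edgeMark (some Mark.dot)) (T.graft dotMarks S) := by
  induction T generalizing S with
  | leaf => exact Or.inr ⟨rfl, hS 0⟩
  | node k hk child ih =>
    refine Or.inl ⟨rfl, ?_⟩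
    simp only [graft, IsKernelTree]
    exact fun b => ih b _ fun α => hS _

theorem exists_graft (S : DecTree) (m : Option Mark) (hS : IsPiece m S) :
    ∃ (T : PTree) (A : ℕ → DecTree), (∀ α, IsKernelTree true (A α)) ∧ S = T.graft dotMarks A ∧
      m = T.edgeMark (some Mark.dot) := by
  induction S generalizing m with
  | leaf =>
    obtain ⟨-, h⟩ | ⟨rfl, h⟩ := hS
    · simp [IsKernelTree] at h
    · exact ⟨leaf, fun _ => .leaf, fun _ => h, rfl, rfl⟩
  | node k hk mark child ih =>
    obtain ⟨rfl, h⟩ | ⟨rfl, h⟩ := hS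
    · simp only [IsKernelTree] at h
      choose T A hA hT hm using fun b => ih b (mark b) (h b)
      obtain ⟨F, hF, hFk⟩ := exists_glue (fun b => (T b).leaves) A (IsKernelTree true) .leaf
        (by simp [IsKernelTree]) hA
      refine ⟨node k hk T, F, hFk, ?_, rfl⟩
      simp only [graft, DecTree.node.injEq, heq_eq_eq, true_and]
      refine ⟨funext hm, funext fun b => ?_⟩
      rw [hT b]
      exact graft_congr _ (fun _ _ => rfl) fun α hα => (hF b α hα).symm
    · exact ⟨leaf, fun _ => .node k hk mark child, fun _ => h, rfl, rfl⟩

theorem circlePiece_graft (T : PTree) (S : ℕ → DecTree) :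
    (if T.edgeMark (some Mark.dot) = some Mark.circle then (T.graft dotMarks S).circlePiece
      else leaf) = T := by
  induction T generalizing S with
  | leaf => rfl
  | node k hk child ih =>
    rw [if_pos (show (node k hk child).edgeMark (some Mark.dot) = some Mark.circle from rfl)]
    simp only [graft, circlePiece, dotMarks]
    congr 1
    ext b
    exact ih b _

theorem circleParts_graft (T : PTree) (S : ℕ → DecTree) :
    (if T.edgeMark (some Mark.dot) = some Mark.circle then (T.graft dotMarks S).circleParts
      else [T.graft dotMarks S]) = (List.range T.leaves).map S := by
  induction T generalizing S with
  | leaf => simp [edgeMark, graft, leaves]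
  | node k hk child ih =>
    rw [if_pos (show (node k hk child).edgeMark (some Mark.dot) = some Mark.circle from rfl)]
    simp only [graft, circleParts, leaves]
    rw [← flatMap_blocks]
    exact congrArg (fun f => List.flatMap f (List.finRange k)) (funext fun b => ih b _)

theorem signAux_graft (T : PTree) (S : ℕ → DecTree) :
    signAux (!decide (T.edgeMark (some Mark.dot) = some Mark.circle)) (T.graft dotMarks S) =
      ∑ α ∈ Finset.range T.leaves, (S α).eps := by
  induction T generalizing S with
  | leaf => simp [edgeMark, graft, leaves, eps]
  | node k hk child ih =>
    simp only [edgeMark, decide_true, Bool.not_true]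
    simp only [graft, signAux, leaves]
    rw [← sum_blocks (fun c => (child c).leaves)]
    exact Finset.sum_congr rfl fun b _ => ih b _

section Top

variable {k : ℕ} {hk : 2 ≤ k} {child : Fin k → PTree} {i : ℕ}

theorem RootFrom.cases (h : (node k hk child).RootFrom i) (b : Fin k) :
    blockStart (fun c => (child c).leaves) b < i ∧
        blockStart (fun c => (child c).leaves) b + (child b).leaves ≤ i ∨
      i ≤ blockStart (fun c => (child c).leaves) b ∧ child b = leaf := by
  by_cases hb : blockStart (fun c => (child c).leaves) b + (child b).leaves ≤ i
  · have := (child b).leaves_pos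
    exact Or.inl ⟨by omega, hb⟩
  · have hleaf := h b (not_le.1 hb)
    rw [hleaf] at hb
    simp only [leaves] at hb
    exact Or.inr ⟨by omega, hleaf⟩

theorem RootFrom.exists_eq (h : (node k hk child).RootFrom i) (hi : i < (node k hk child).leaves) :
    ∃ j, blockStart (fun c => (child c).leaves) j = i ∧ child j = leaf := by
  obtain ⟨j, a, ha, rfl⟩ := exists_block (fun c => (child c).leaves) hi
  have hleaf := h j (by omega)
  rw [hleaf] at ha
  simp only [leaves] at ha
  exact ⟨j, by omega, hleaf⟩

theorem graft_topMarks (h : (node k hk child).RootFrom i) (S : ℕ → DecTree) :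
    (node k hk child).graft (topMarks i) S = .node k hk
      (fun b => (child b).edgeMark (topMarks i (blockStart (fun c => (child c).leaves) b)))
      fun b => (child b).graft dotMarks
        fun α => S (blockStart (fun c => (child c).leaves) b + α) := by
  simp only [graft, DecTree.node.injEq, heq_eq_eq, true_and]
  funext b
  obtain ⟨h1, h2⟩ | ⟨-, h2⟩ := h.cases b
  · exact graft_congr _ (fun α hα => topMarks_of_lt (by omega)) fun _ _ => rfl
  · rw [h2]
    rfl

theorem edgeMark_topMarks_of_lt {b : Fin k}
    (hb : blockStart (fun c => (child c).leaves) b < i) :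
    (child b).edgeMark (topMarks i (blockStart (fun c => (child c).leaves) b)) =
      (child b).edgeMark (some Mark.dot) := by
  rw [topMarks_of_lt hb]

theorem isLeft_topMarks (h : (node k hk child).RootFrom i) (hi : i < (node k hk child).leaves)
    (b : Fin k) :
    IsLeft (fun b => (child b).edgeMark (topMarks i (blockStart (fun c => (child c).leaves) b))) b
      ↔ blockStart (fun c => (child c).leaves) b < i := by
  constructor
  · rintro ⟨c, hbc, hc⟩
    have h1 := blockStart_mono (fun c => (child c).leaves) hbc
    have h2 := (child b).leaves_pos
    obtain h3 | ⟨h3, h4⟩ := h.cases c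
    · omega
    · simp only [h4] at hc
      have := topMarks_ne_none_iff.1 hc
      omega
  · intro hb
    obtain ⟨j, hj, hleaf⟩ := h.exists_eq hi
    refine ⟨j, ?_, ?_⟩
    · by_contra hbj
      obtain h1 | h1 := (not_lt.1 hbj).lt_or_eq
      · have := blockStart_mono (fun c => (child c).leaves) h1
        omega
      · rw [← h1, hj] at hb
        omega
    · simp only [hleaf, hj, edgeMark, topMarks_self]
      simp

variable (S : ℕ → DecTree)

theorem topPiece_graft (h : (node k hk child).RootFrom i) (hi : i < (node k hk child).leaves) :
    ((node k hk child).graft (topMarks i) S).topPiece = node k hk child := by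
  rw [graft_topMarks h]
  simp only [topPiece, isLeft_topMarks h hi]
  congr 1
  ext b
  obtain ⟨h1, -⟩ | ⟨h1, h2⟩ := h.cases b
  · simp only [h1, true_and, edgeMark_topMarks_of_lt h1]
    exact circlePiece_graft _ _
  · rw [if_neg fun h => absurd h.1 (not_lt.2 h1), h2]

theorem topParts_graft (h : (node k hk child).RootFrom i) (hi : i < (node k hk child).leaves) :
    ((node k hk child).graft (topMarks i) S).topParts = (List.range (i + 1)).map S := by
  have hrange : List.range (i + 1) =
      (List.range (node k hk child).leaves).filter fun α => decide (α ≤ i) := by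
    obtain ⟨m, hm⟩ : ∃ m, (node k hk child).leaves = i + 1 + m :=
      ⟨(node k hk child).leaves - (i + 1), by omega⟩
    rw [hm, List.range_add (n := i + 1) (m := m), List.filter_append,
      List.filter_eq_self.2, List.filter_eq_nil_iff.2, List.append_nil]
    · simp only [List.mem_map, decide_eq_true_eq]
      rintro _ ⟨a, -, rfl⟩
      omega
    · intro a ha
      simpa [Nat.lt_succ_iff] using ha
  rw [graft_topMarks h, hrange]
  simp only [topParts, isLeft_topMarks h hi]
  have hblocks := flatMap_blocks (fun c => (child c).leaves) fun α => α
  rw [List.map_id'] at hblocks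
  simp only [leaves]
  rw [← hblocks, List.filter_flatMap, List.map_flatMap]
  refine congrArg (fun f => List.flatMap f (List.finRange k)) (funext fun b => ?_)
  obtain ⟨h1, h2⟩ | ⟨h1, h2⟩ := h.cases b
  · rw [if_pos h1, List.filter_eq_self.2]
    · rw [List.map_map]
      simp only [edgeMark_topMarks_of_lt h1]
      exact circleParts_graft _ _
    · simp only [List.mem_map, List.mem_range, decide_eq_true_eq]
      rintro _ ⟨a, ha, rfl⟩
      omega
  · rw [if_neg (not_lt.2 h1), h2]
    simp only [edgeMark, topMarks_ne_none_iff, leaves, graft, add_zero]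
    obtain h3 | h3 := h1.eq_or_lt
    · simp [← h3, List.range_succ]
    · simp [not_le.2 h3, List.range_succ]

theorem eps_graft (h : (node k hk child).RootFrom i) (hi : i < (node k hk child).leaves) :
    ((node k hk child).graft (topMarks i) S).eps =
      ((node k hk child).graft (topMarks i) S).localSign +
        ∑ α ∈ Finset.range (node k hk child).leaves, (S α).eps := by
  rw [graft_topMarks h, eps, signAux]
  congr 1
  simp only [leaves]
  rw [← sum_blocks (fun c => (child c).leaves)]
  refine Finset.sum_congr rfl fun b _ => ?_
  simp only [isLeft_topMarks h hi]
  obtain ⟨h1, h2⟩ | ⟨h1, h2⟩ := h.cases b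
  · simp only [h1, true_and, edgeMark_topMarks_of_lt h1]
    exact signAux_graft _ _
  · simp [not_lt.2 h1, h2, graft, leaves, eps]

theorem isKernelTree_graft (h : (node k hk child).RootFrom i)
    (hi : i < (node k hk child).leaves) (hS : ∀ α, IsKernelTree true (S α))
    (hleaf : ∀ α < (node k hk child).leaves, i < α → S α = .leaf) :
    IsKernelTree true ((node k hk child).graft (topMarks i) S) := by
  rw [graft_topMarks h]
  simp only [IsKernelTree]
  obtain ⟨j, hj, hjl⟩ := h.exists_eq hi
  refine ⟨j, fun b hb => ?_, ?_, ?_, fun b hb => ?_⟩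
  · have h1 := blockStart_mono (fun c => (child c).leaves) hb
    have h2 := (child b).leaves_pos
    rw [edgeMark_topMarks_of_lt (by omega)]
    exact isPiece_graft _ _ fun α => hS _
  · simp only [hjl, hj, edgeMark, topMarks_self]
  · rw [hjl]
    exact hS _
  · have h1 := blockStart_mono (fun c => (child c).leaves) hb
    have h2 := (child j).leaves_pos
    have h3 := blockStart_add_le (fun c => (child c).leaves) b
    have h4 := (child b).leaves_pos
    obtain h5 | ⟨-, h5⟩ := h.cases b
    · omega
    · rw [h5]
      refine ⟨topMarks_of_gt (by omega), hleaf _ ?_ ?_⟩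
      · simp only [leaves]
        omega
      · omega

theorem exists_graft_topMarks {mark : Fin k → Option Mark} {child : Fin k → DecTree}
    (hS : IsKernelTree true (.node k hk mark child)) :
    ∃ (T : PTree) (i : ℕ) (A : ℕ → DecTree), T.RootFrom i ∧ i < T.leaves ∧
      (∀ α, IsKernelTree true (A α)) ∧ (∀ α < T.leaves, i < α → A α = .leaf) ∧
      DecTree.node k hk mark child = T.graft (topMarks i) A := by
  simp only [IsKernelTree] at hS
  obtain ⟨j, h1, h2, h3, h4⟩ := hS
  have hex : ∀ b, ∃ (T : PTree) (A : ℕ → DecTree), (∀ α, IsKernelTree true (A α)) ∧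
      child b = T.graft dotMarks A ∧ (b < j → mark b = T.edgeMark (some Mark.dot)) ∧
      (j ≤ b → T = leaf) := by
    intro b
    by_cases hb : b < j
    · obtain ⟨T, A, hA, hT, hm⟩ := exists_graft (child b) (mark b) (h1 b hb)
      exact ⟨T, A, hA, hT, fun _ => hm, fun h => absurd hb (not_lt.2 h)⟩
    · refine ⟨leaf, fun _ => child b, fun _ => ?_, rfl, fun h => absurd h hb, fun _ => rfl⟩
      obtain h | rfl := (not_lt.1 hb).lt_or_eq
      · rw [(h4 b h).2]
        simp [IsKernelTree]
      · exact h3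
  choose T A hA hT hm hl using hex
  obtain ⟨F, hF, hFk⟩ := exists_glue (fun b => (T b).leaves) A (IsKernelTree true) .leaf
    (by simp [IsKernelTree]) hA
  have hroot : (node k hk T).RootFrom (blockStart (fun c => (T c).leaves) j) := by
    intro b hb
    refine hl b (not_lt.1 fun hbj => ?_)
    have := blockStart_mono (fun c => (T c).leaves) hbj
    omega
  refine ⟨node k hk T, blockStart (fun c => (T c).leaves) j, F, hroot, ?_, hFk, ?_, ?_⟩
  · have h5 := blockStart_add_le (fun c => (T c).leaves) j
    have h6 := (T j).leaves_pos
    simp only [leaves]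
    omega
  · intro α hα hjα
    obtain ⟨b, a, ha, rfl⟩ := exists_block (fun c => (T c).leaves) hα
    rw [hF b a ha]
    have hjb : j < b := by
      by_contra hbj
      obtain h | h := (not_lt.1 hbj).lt_or_eq
      · have := blockStart_mono (fun c => (T c).leaves) h
        omega
      · rw [h, hl j le_rfl] at ha
        simp only [leaves] at ha
        rw [h] at hjα
        omega
    have h5 := hT b
    rw [(h4 b hjb).2, hl b hjb.le] at h5
    rw [hl b hjb.le] at ha
    simp only [leaves, Nat.lt_one_iff] at ha
    rw [ha]
    exact h5.symm
  · rw [graft_topMarks hroot]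
    simp only [DecTree.node.injEq, heq_eq_eq, true_and]
    refine ⟨funext fun b => ?_, funext fun b => ?_⟩
    · rcases lt_trichotomy b j with hb | rfl | hb
      · rw [hm b hb, edgeMark_topMarks_of_lt]
        have h5 := blockStart_mono (fun c => (T c).leaves) hb
        have h6 := (T b).leaves_pos
        omega
      · rw [hl b le_rfl, h2]
        exact (topMarks_self _).symm
      · rw [hl b hb.le, (h4 b hb).1]
        refine (topMarks_of_gt ?_).symm
        have h5 := blockStart_mono (fun c => (T c).leaves) hb
        have h6 := (T j).leaves_pos
        omega
    · conv_lhs => rw [hT b]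
      exact graft_congr _ (fun _ _ => rfl) fun α hα => (hF b α hα).symm

end Top

end PTree

/-! ### The q-kernel as a sum over decorated trees -/

open DecTree PTree

/-- The decorated trees with `n` leaves that occur in the expansion of the q-kernel. -/
abbrev QTree (n : ℕ) : Type := {S : DecTree // S.leaves = n ∧ IsKernelTree true S}

/-- A finite family of trees, extended to a sequence by trivial trees. -/
def extendLeaf {k : ℕ} (S : Fin k → DecTree) : ℕ → DecTree := fun α =>
  if hα : α < k then S ⟨α, hα⟩ else .leaf

@[simp]
theorem extendLeaf_val {k : ℕ} (S : Fin k → DecTree) (b : Fin k) : extendLeaf S b = S b := by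
  simp [extendLeaf]

theorem extendLeaf_of_lt {k : ℕ} (S : Fin k → DecTree) {α : ℕ} (hα : α < k) :
    extendLeaf S α = S ⟨α, hα⟩ := dif_pos hα

theorem isKernelTree_extendLeaf {k : ℕ} {S : Fin k → DecTree}
    (hS : ∀ b, IsKernelTree true (S b)) (α : ℕ) : IsKernelTree true (extendLeaf S α) := by
  by_cases hα : α < k
  · rw [extendLeaf_of_lt S hα]
    exact hS _
  · simp [extendLeaf, hα, IsKernelTree]

/-- The summation range of the recursion for the q-kernel, when the kernels on its right hand side
are expanded. -/
abbrev KernelIndex (n : ℕ) : Type :=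
  Σ c : {c : Composition n // 2 ≤ c.length},
    Σ i : {i : Fin c.1.length // ∀ b, i < b → c.1.blocksFun b = 1},
      (∀ b, QTree (c.1.blocksFun b)) × {T : PTree // T.leaves = c.1.length ∧ T.RootFrom i.1}

/-- The decorated tree that belongs to a summand. -/
def KernelIndex.tree {n : ℕ} (p : KernelIndex n) : DecTree :=
  p.2.2.2.1.graft (topMarks p.2.1.1) (extendLeaf fun b => (p.2.2.1 b).1)

namespace KernelIndex

variable {n : ℕ} (p : KernelIndex n)

theorem leaves_tree : p.tree.leaves = n := by
  obtain ⟨c, i, S, T⟩ := p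
  rw [tree, leaves_graft, T.2.1, ← Fin.sum_univ_eq_sum_range]
  simp only [extendLeaf_val, fun b => (S b).2.1]
  exact c.1.sum_blocksFun

theorem extendLeaf_of_gt (α : ℕ) (hα : (p.2.1.1 : ℕ) < α) :
    extendLeaf (fun b => (p.2.2.1 b).1) α = .leaf := by
  obtain ⟨c, i, S, T⟩ := p
  by_cases h : α < c.1.length
  · rw [extendLeaf_of_lt _ h]
    exact DecTree.eq_leaf_of_leaves_eq_one ((S _).2.1.trans (i.2 ⟨α, h⟩ hα))
  · simp [extendLeaf, h]

theorem isKernelTree_tree : IsKernelTree true p.tree := by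
  have hleaf := p.extendLeaf_of_gt
  obtain ⟨c, i, S, ⟨T, hT⟩⟩ := p
  cases T with
  | leaf => exact absurd hT.2 id
  | node k hk child =>
    exact isKernelTree_graft _ hT.2 (by rw [hT.1]; exact i.1.2)
      (isKernelTree_extendLeaf fun b => (S b).2.2) fun α _ hα => hleaf α hα

theorem topPiece_tree : p.tree.topPiece = p.2.2.2.1 := by
  obtain ⟨c, i, S, ⟨T, hT⟩⟩ := p
  cases T with
  | leaf => exact absurd hT.2 id
  | node k hk child => exact topPiece_graft _ hT.2 (by rw [hT.1]; exact i.1.2)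

theorem topParts_tree : p.tree.topParts =
    (List.range (p.2.1.1 + 1)).map (extendLeaf fun b => (p.2.2.1 b).1) := by
  obtain ⟨c, i, S, ⟨T, hT⟩⟩ := p
  cases T with
  | leaf => exact absurd hT.2 id
  | node k hk child => exact topParts_graft _ hT.2 (by rw [hT.1]; exact i.1.2)

theorem eps_tree : p.tree.eps = p.tree.localSign + ∑ b, (p.2.2.1 b).1.eps := by
  obtain ⟨c, i, S, ⟨T, hT⟩⟩ := p
  cases T with
  | leaf => exact absurd hT.2 id
  | node k hk child =>
    refine (eps_graft _ hT.2 (by rw [hT.1]; exact i.1.2)).trans ?_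
    rw [hT.1, ← Fin.sum_univ_eq_sum_range]
    simp only [extendLeaf_val]
    rfl

theorem tree_injective : Function.Injective (tree (n := n)) := by
  intro p p' h
  have hT := congrArg topPiece h
  have hL := congrArg topParts h
  rw [topPiece_tree, topPiece_tree] at hT
  rw [topParts_tree, topParts_tree] at hL
  have hi : (p.2.1.1 : ℕ) = p'.2.1.1 := by
    have := congrArg List.length hL
    simpa using this
  have hS : extendLeaf (fun b => (p.2.2.1 b).1) = extendLeaf fun b => (p'.2.2.1 b).1 := by
    funext α
    by_cases hα : α ≤ p.2.1.1
    · have hrange : List.range ((p'.2.1.1 : ℕ) + 1) = List.range ((p.2.1.1 : ℕ) + 1) := by rw [hi]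
      rw [hrange] at hL
      exact List.map_inj_left.1 hL α (by simpa [Nat.lt_succ_iff] using hα)
    · rw [p.extendLeaf_of_gt α (not_le.1 hα), p'.extendLeaf_of_gt α (hi ▸ not_le.1 hα)]
  obtain ⟨⟨c, hc⟩, ⟨i, hi1⟩, S, ⟨T, hT1⟩⟩ := p
  obtain ⟨⟨c', hc'⟩, ⟨i', hi1'⟩, S', ⟨T', hT1'⟩⟩ := p'
  obtain rfl : T = T' := hT
  simp only at hi hS
  have hlen : c.length = c'.length := hT1.1.symm.trans hT1'.1
  obtain rfl : c = c' := by
    have hblocks : ∀ (c : Composition n) (S : ∀ b, QTree (c.blocksFun b)),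
        c.blocks = (List.range c.length).map fun α => (extendLeaf (fun b => (S b).1) α).leaves := by
      intro c S
      refine List.ext_get (by simp) fun α h1 h2 => ?_
      have h3 : α < c.length := h1
      simp only [List.get_eq_getElem, List.getElem_map, List.getElem_range,
        extendLeaf_of_lt _ h3, (S ⟨α, h3⟩).2.1]
      rfl
    ext1
    rw [hblocks c S, hblocks c' S', hS, hlen]
  obtain rfl : i = i' := Fin.ext hi
  obtain rfl : S = S' := by
    funext b
    have := congrFun hS b
    rw [extendLeaf_val, extendLeaf_val] at this
    exact Subtype.ext this
  rfl

theorem exists_tree_eq {S : DecTree} (hn : S.leaves = n) (hS : IsKernelTree true S)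
    (hleaf : S ≠ .leaf) : ∃ p : KernelIndex n, p.tree = S := by
  cases S with
  | leaf => exact absurd rfl hleaf
  | node k hk mark child =>
    obtain ⟨T, i, A, hT, hi, hA, hAl, heq⟩ := exists_graft_topMarks hS
    have hsum : ∑ α ∈ Finset.range T.leaves, (A α).leaves = n := by
      rw [← leaves_graft T (topMarks i), ← heq, hn]
    have hT2 : 2 ≤ T.leaves := by
      cases T with
      | leaf => exact absurd hT id
      | node k hk child => exact hk.trans (arity_le_leaves k hk child)
    let c : Composition n := ⟨(List.range T.leaves).map fun α => (A α).leaves, by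
      intro r hr
      obtain ⟨α, -, rfl⟩ := List.mem_map.1 hr
      exact DecTree.leaves_pos _, by rw [← hsum]; rfl⟩
    have hlen : c.length = T.leaves := by simp [c, Composition.length]
    have hblocks : ∀ b, c.blocksFun b = (A b).leaves := by
      intro b
      simp [c, Composition.blocksFun]
    refine ⟨⟨⟨c, hlen ▸ hT2⟩, ⟨⟨i, lt_of_lt_of_eq hi hlen.symm⟩, fun b hb => ?_⟩,
      fun b => ⟨A b, (hblocks b).symm, hA b⟩, ⟨T, hlen.symm, hT⟩⟩, ?_⟩
    · rw [hblocks, hAl b (lt_of_lt_of_eq b.2 hlen) hb]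
      rfl
    · rw [heq]
      refine graft_congr _ (fun _ _ => rfl) fun α hα => ?_
      exact extendLeaf_of_lt _ (lt_of_lt_of_eq hα hlen.symm)

end KernelIndex

instance finite_qTree (n : ℕ) : Finite (QTree n) := by
  induction n using Nat.strong_induction_on with
  | _ n ih =>
    have (c : {c : Composition n // 2 ≤ c.length}) :
        Finite (∀ b, QTree (c.1.blocksFun b)) :=
      @Pi.finite _ _ _ fun b => ih _ (blocksFun_lt c.1 c.2 b)
    have hfin : Finite (KernelIndex n) := inferInstance
    refine Set.Finite.subset ((Set.finite_range (KernelIndex.tree (n := n))).union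
      (Set.finite_singleton DecTree.leaf)) fun S hS => ?_
    by_cases h : S = .leaf
    · exact Or.inr h
    · exact Or.inl (KernelIndex.exists_tree_eq hS.1 hS.2 h)

instance (n : ℕ) : Fintype (QTree n) := Fintype.ofFinite _

theorem KernelIndex.tree_bijective {n : ℕ} (hn : 2 ≤ n) :
    Function.Bijective (fun p => ⟨p.tree, p.leaves_tree, p.isKernelTree_tree⟩ :
      KernelIndex n → QTree n) := by
  constructor
  · exact fun p p' h => tree_injective (congrArg Subtype.val h)
  · rintro ⟨S, hS1, hS2⟩
    obtain ⟨p, hp⟩ := exists_tree_eq hS1 hS2 (by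
      rintro rfl
      simp only [DecTree.leaves] at hS1
      omega)
    exact ⟨p, Subtype.ext hp⟩

theorem sum_Ioi_fin {k : ℕ} (f : ℕ → ℤ) (b : Fin k) :
    ∑ c ∈ Finset.Ioi b, f c = ∑ β ∈ Finset.Ioo (b : ℕ) k, f β := by
  refine Finset.sum_nbij (fun c => (c : ℕ)) ?_ ?_ ?_ ?_
  · intro c hc
    have hc : b < c := by simpa using hc
    simpa using hc
  · intro c _ c' _ h
    exact Fin.ext h
  · intro β hβ
    simp only [Finset.coe_Ioo, Set.mem_Ioo] at hβ
    exact ⟨⟨β, hβ.2⟩, Finset.mem_coe.2 (Finset.mem_Ioi.2 hβ.1), rfl⟩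
  · intro c _
    rfl

theorem sum_Iio_fin {k : ℕ} (f : ℕ → ℕ) (b : Fin k) :
    ∑ c ∈ Finset.Iio b, f c = ∑ β ∈ Finset.range b, f β := by
  refine Finset.sum_nbij (fun c => (c : ℕ)) ?_ ?_ ?_ ?_
  · intro c hc
    have hc : c < b := by simpa using hc
    simpa using hc
  · intro c _ c' _ h
    exact Fin.ext h
  · intro β hβ
    simp only [Finset.coe_range, Set.mem_Iio] at hβ
    exact ⟨⟨β, hβ.trans b.2⟩, Finset.mem_coe.2 (Finset.mem_Iio.2 hβ), rfl⟩
  · intro c _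
    rfl

theorem koszul_congr (T : PTree) {d d' : ℕ → ℤ} (h : ∀ α < T.leaves, d α = d' α) :
    T.koszul (fun α => d α) = T.koszul fun α => d' α :=
  congrArg T.koszul (funext fun α => h α α.2)

/-- The degree of the decorated tree attached to the `α`-th leaf. -/
def leafDegree {k : ℕ} (i : ℕ) (S : Fin k → DecTree) (α : ℕ) : ℤ :=
  markDegree (topMarks i α) + (extendLeaf S α).degree

theorem leafDegree_val {k : ℕ} (i : Fin k) (S : Fin k → DecTree)
    (hS : ∀ b, IsKernelTree true (S b)) (b : Fin k) :
    leafDegree i S b = if b = i then ((S b).leaves : ℤ) else (S b).leaves - 1 := by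
  rw [leafDegree, extendLeaf_val, (degree_of_isKernelTree (S b)).1 (hS b)]
  rcases lt_trichotomy b i with h | rfl | h
  · rw [topMarks_of_lt h, if_neg h.ne]
    simp [markDegree]
  · rw [topMarks_self, if_pos rfl, markDegree]
    ring
  · rw [topMarks_of_gt h, if_neg h.ne']
    simp [markDegree]

namespace KernelIndex

variable {n : ℕ} (p : KernelIndex n)

/-- The degrees of the maps that are plugged into the inputs of the p-kernel. -/
abbrev degrees (α : ℕ) : ℤ := leafDegree p.2.1.1 (fun b => (p.2.2.1 b).1) α

theorem degrees_val (b : Fin p.1.1.length) :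
    p.degrees b = if b = p.2.1.1 then (p.1.1.blocksFun b : ℤ) else p.1.1.blocksFun b - 1 := by
  rw [degrees, leafDegree_val _ _ fun b => (p.2.2.1 b).2.2, (p.2.2.1 b).2.1]

theorem sizes_tree : p.tree.sizes = p.1.1.blocks.take (p.2.1.1 + 1) := by
  rw [sizes, topParts_tree, List.map_map]
  refine List.ext_get ?_ fun α h1 h2 => ?_
  · have := p.2.1.1.2
    simp only [List.length_map, List.length_range, List.length_take]
    exact (min_eq_left this).symm
  · have h3 : α < p.1.1.length := by
      simp only [List.length_take] at h2
      exact lt_of_lt_of_le h2 (min_le_right _ _)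
    simp only [List.get_eq_getElem, List.getElem_map, List.getElem_range, Function.comp_apply,
      extendLeaf_of_lt _ h3, (p.2.2.1 ⟨α, h3⟩).2.1, List.getElem_take]
    rfl

theorem localSign_tree : p.tree.localSign =
    (n : ℤ) + p.1.1.blocksFun p.2.1.1 + theta (p.1.1.blocks.take (p.2.1.1 + 1)) +
      p.2.2.2.1.vartheta + p.2.2.2.1.koszul fun α => p.degrees α := by
  have hi := p.2.1.1.2
  have hlen : p.tree.sizes.length = p.2.1.1 + 1 := by
    rw [sizes_tree, List.length_take]
    exact min_eq_left hi
  have hget : ∀ α (hα : α < p.1.1.length), α ≤ p.2.1.1 →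
      p.tree.sizes.getD α 0 = p.1.1.blocksFun ⟨α, hα⟩ := by
    intro α hα hαi
    rw [sizes_tree, List.getD_eq_getElem _ _ (by
      rw [← sizes_tree, hlen]
      omega), List.getElem_take]
    rfl
  have hlast : p.tree.sizes.getLastD 0 = p.1.1.blocksFun p.2.1.1 := by
    rw [← hget _ hi le_rfl, List.getLastD_eq_getLast?, List.getLast?_eq_getElem?, hlen,
      List.getD_eq_getElem?_getD]
    simp
  have hkos : (p.2.2.2.1.koszul fun α => pluggedDegree p.tree.sizes α) =
      p.2.2.2.1.koszul fun α => p.degrees α := by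
    refine koszul_congr _ fun α hα => ?_
    rw [p.2.2.2.2.1] at hα
    have h1 := p.degrees_val ⟨α, hα⟩
    simp only at h1
    rw [h1, pluggedDegree, hlen]
    rcases lt_trichotomy α p.2.1.1 with h | h | h
    · rw [if_pos (by omega), if_neg (by simp [Fin.ext_iff]; omega), hget α hα h.le]
    · rw [if_neg (by omega), if_pos (by omega), if_pos (Fin.ext h), hget α hα h.le]
    · rw [if_neg (by omega), if_neg (by omega), if_neg (by simp [Fin.ext_iff]; omega),
        p.2.1.2 ⟨α, hα⟩ h]
      simp
  rw [localSign, topPiece_tree, hkos, hlast, leaves_tree, sizes_tree]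

end KernelIndex

section Kernels

variable {R V : Type*} [CommRing R] [AddCommGroup V] [Module R V]
variable (𝒱 : ℤ → Submodule R V) [DirectSum.Decomposition 𝒱]
variable (μ : ∀ n, Op R V n) (h e : V →ₗ[R] V)

/-- Composition of a p-kernel tree with the trees plugged into it. -/
theorem KernelIndex.treeEval_eq
    (hh : ∀ i, ∀ x ∈ 𝒱 i, h x ∈ 𝒱 (i + 1)) (he : ∀ i, ∀ x ∈ 𝒱 i, e x ∈ 𝒱 i)
    (hμ : ∀ n : ℕ, 2 ≤ n → ∀ (a : Fin n → ℤ) (x : Fin n → V), (∀ j, x j ∈ 𝒱 (a j)) →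
      μ n x ∈ 𝒱 ((∑ j, a j) + n - 2))
    {n : ℕ} (p : KernelIndex n) (x : ℕ → V) :
    p.2.2.2.1.treeEval 𝒱 μ h (fun α => DecTree.markMap h e (topMarks p.2.1.1 α)
      (evalSeq ((extendLeaf (fun b => (p.2.2.1 b).1) α).flow 𝒱 μ h e) fun j =>
        koszulTwist 𝒱 (∑ β ∈ Finset.Ioo α p.1.1.length, p.degrees β)
          (x (∑ β ∈ Finset.range α, (extendLeaf (fun b => (p.2.2.1 b).1) β).leaves + j)))) =
      sgn R (p.2.2.2.1.koszul fun α => p.degrees α) • evalSeq (p.tree.flow 𝒱 μ h e) x := by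
  have hT : p.2.2.2.1 ≠ PTree.leaf := by
    intro hT
    have h1 := p.2.2.2.2.1
    have h2 := p.1.2
    rw [hT] at h1
    simp only [PTree.leaves] at h1
    omega
  have h1 := p.2.2.2.1.treeEval_comp 𝒱 μ h
    (fun α => (extendLeaf (fun b => (p.2.2.1 b).1) α).leaves) p.degrees
    (fun α y => DecTree.markMap h e (topMarks p.2.1.1 α)
      (evalSeq ((extendLeaf (fun b => (p.2.2.1 b).1) α).flow 𝒱 μ h e) y))
    (fun α t y => koszulTwist_flow 𝒱 μ h e hh he hμ _ _ t y) x
  have hIoo : ∀ α, Finset.Ioo α p.1.1.length = Finset.Ioo α p.2.2.2.1.leaves := fun α => by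
    rw [p.2.2.2.2.1]
  simp only [hIoo]
  rw [h1, KernelIndex.tree, (PTree.nestEval_flow 𝒱 μ h e _ _ _ x).2 hT]
  rfl

theorem evalSeq_blockComp_pKernelAt
    (hh : ∀ i, ∀ x ∈ 𝒱 i, h x ∈ 𝒱 (i + 1)) (he : ∀ i, ∀ x ∈ 𝒱 i, e x ∈ 𝒱 i)
    (hμ : ∀ n : ℕ, 2 ≤ n → ∀ (a : Fin n → ℤ) (x : Fin n → V), (∀ j, x j ∈ 𝒱 (a j)) →
      μ n x ∈ 𝒱 ((∑ j, a j) + n - 2))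
    {n : ℕ} (c : {c : Composition n // 2 ≤ c.length})
    (i : {i : Fin c.1.length // ∀ b, i < b → c.1.blocksFun b = 1})
    (hq : ∀ b y, evalSeq (qKernel 𝒱 μ h e (c.1.blocksFun b)) y =
      ∑ S : QTree (c.1.blocksFun b), sgn R S.1.eps • evalSeq (S.1.flow 𝒱 μ h e) y) (x : ℕ → V) :
    sgn R ((n : ℤ) + c.1.blocksFun i.1 + theta (c.1.blocks.take (i.1 + 1))) •
      evalSeq (castOp c.1.sum_blocksFun
        (blockComp 𝒱 (pKernelAt 𝒱 μ h c.1.length i.1)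
          (fun b => if b = i.1 then (c.1.blocksFun b : ℤ) else c.1.blocksFun b - 1)
          fun b => (if b < i.1 then e else if b = i.1 then h else LinearMap.id).compMultilinearMap
            (qKernel 𝒱 μ h e (c.1.blocksFun b)))) x =
      ∑ S : (∀ b, QTree (c.1.blocksFun b)),
        ∑ T : {T : PTree // T.leaves = c.1.length ∧ T.RootFrom i.1},
          sgn R (KernelIndex.tree ⟨c, i, S, T⟩).eps •
            evalSeq ((KernelIndex.tree ⟨c, i, S, T⟩).flow 𝒱 μ h e) x := by
  classical
  have hmark : ∀ b, (if b < i.1 then e else if b = i.1 then h else LinearMap.id) =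
      DecTree.markMap h e (topMarks i.1 b) := by
    intro b
    rcases lt_trichotomy b i.1 with hb | rfl | hb
    · rw [if_pos hb, topMarks_of_lt hb]
      rfl
    · rw [if_neg (lt_irrefl _), if_pos rfl, topMarks_self]
      rfl
    · rw [if_neg hb.not_gt, if_neg hb.ne', topMarks_of_gt hb]
      rfl
  rw [evalSeq_castOp, evalSeq_blockComp]
  simp only [evalSeq_compMultilinearMap, hq, map_sum, map_smul, hmark]
  rw [MultilinearMap.map_sum, Finset.smul_sum]
  refine Finset.sum_congr rfl fun S _ => ?_
  rw [MultilinearMap.map_smul_univ]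
  let y : ℕ → V := fun α => DecTree.markMap h e (topMarks i.1 α)
    (evalSeq ((extendLeaf (fun b => (S b).1) α).flow 𝒱 μ h e) fun j => koszulTwist 𝒱
      (∑ β ∈ Finset.Ioo α c.1.length, leafDegree i.1 (fun b => (S b).1) β)
      (x (∑ β ∈ Finset.range α, (extendLeaf (fun b => (S b).1) β).leaves + j)))
  have hy : (fun b : Fin c.1.length => DecTree.markMap h e (topMarks i.1 b)
        (evalSeq ((S b).1.flow 𝒱 μ h e) fun j => koszulTwist 𝒱
          (∑ b ∈ Finset.Ioi b, if b = i.1 then (c.1.blocksFun b : ℤ) else c.1.blocksFun b - 1)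
          (x (blockStart c.1.blocksFun b + j)))) = fun b : Fin c.1.length => y b := by
    funext b
    simp only [y]
    rw [extendLeaf_val, ← sum_Ioi_fin, ← sum_Iio_fin]
    simp only [extendLeaf_val, leafDegree_val _ _ fun b => (S b).2.2, fun b => (S b).2.1,
      blockStart]
  rw [hy]
  change _ • _ • evalSeq (pKernelAt 𝒱 μ h c.1.length i.1) y = _
  rw [evalSeq_pKernelAt, Finset.smul_sum, Finset.smul_sum]
  refine Finset.sum_congr rfl fun T _ => ?_
  rw [show T.1.treeEval 𝒱 μ h y = _ from
    KernelIndex.treeEval_eq 𝒱 μ h e hh he hμ ⟨c, i, S, T⟩ x]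
  simp only [smul_smul, ← sgn_sum, ← sgn_add]
  rw [KernelIndex.eps_tree, KernelIndex.localSign_tree]
  congr 2
  ring

theorem evalSeq_qKernel
    (hh : ∀ i, ∀ x ∈ 𝒱 i, h x ∈ 𝒱 (i + 1)) (he : ∀ i, ∀ x ∈ 𝒱 i, e x ∈ 𝒱 i)
    (hμ : ∀ n : ℕ, 2 ≤ n → ∀ (a : Fin n → ℤ) (x : Fin n → V), (∀ j, x j ∈ 𝒱 (a j)) →
      μ n x ∈ 𝒱 ((∑ j, a j) + n - 2))
    (n : ℕ) (hn : 0 < n) (x : ℕ → V) :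
    evalSeq (qKernel 𝒱 μ h e n) x =
      ∑ S : QTree n, sgn R S.1.eps • evalSeq (S.1.flow 𝒱 μ h e) x := by
  induction n using Nat.strong_induction_on generalizing x with
  | _ n ih =>
    obtain rfl | hn2 : n = 1 ∨ 2 ≤ n := by omega
    · let : Unique (QTree 1) :=
        { default := ⟨.leaf, rfl, by simp [IsKernelTree]⟩
          uniq := fun S => Subtype.ext (DecTree.eq_leaf_of_leaves_eq_one S.2.1) }
      rw [Fintype.sum_unique, qKernel]
      change x 0 = sgn R DecTree.leaf.eps • x 0
      simp [eps, signAux, sgn_zero]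
    · obtain ⟨m, rfl⟩ : ∃ m, n = m + 2 := ⟨n - 2, by omega⟩
      rw [← (KernelIndex.tree_bijective hn2).sum_comp
        fun S => sgn R S.1.eps • evalSeq (S.1.flow 𝒱 μ h e) x]
      rw [Fintype.sum_sigma, qKernel, evalSeq_sum]
      refine Finset.sum_congr rfl fun c _ => ?_
      rw [Fintype.sum_sigma, evalSeq_sum]
      refine Finset.sum_congr rfl fun i _ => ?_
      rw [Fintype.sum_prod_type, evalSeq_negOnePow_smul]
      have := evalSeq_blockComp_pKernelAt 𝒱 μ h e hh he hμ c i (fun b y =>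
        ih _ (blocksFun_lt c.1 c.2 b) (c.1.blocks_pos (c.1.blocksFun_mem_blocks b)) y) x
      exact_mod_cast this

end Kernels

end CarpKernel

end

theorem mainTheorem3 {R V W : Type*} [CommRing R]
    [AddCommGroup V] [Module R V] [AddCommGroup W] [Module R W]
    (𝒱 : ℤ → Submodule R V) [DirectSum.Decomposition 𝒱]
    (𝒲 : ℤ → Submodule R W) [DirectSum.Decomposition 𝒲]
    (f : V →ₗ[R] W) (g : W →ₗ[R] V) (h : V →ₗ[R] V) (μ : ∀ n : ℕ, CarpKernel.Op R V n)
    (hf : ∀ (i : ℤ) (x : V), x ∈ 𝒱 i → f x ∈ 𝒲 i)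
    (hg : ∀ (i : ℤ) (y : W), y ∈ 𝒲 i → g y ∈ 𝒱 i)
    (hh : ∀ (i : ℤ) (x : V), x ∈ 𝒱 i → h x ∈ 𝒱 (i + 1))
    (hμ : ∀ n : ℕ, 2 ≤ n → ∀ (a : Fin n → ℤ) (x : Fin n → V), (∀ j, x j ∈ 𝒱 (a j)) →
      μ n x ∈ 𝒱 ((∑ j, a j) + n - 2)) :
    CarpKernel.qKernel 𝒱 μ h (g ∘ₗ f) 1 = CarpKernel.idOp ∧
    ∀ n : ℕ, 2 ≤ n →
      (CarpKernel.carpTrees n).Finite ∧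
      CarpKernel.qKernel 𝒱 μ h (g ∘ₗ f) n =
        ∑ᶠ S : CarpKernel.carpTrees n,
          S.1.eps.negOnePow • CarpKernel.castOp S.2.1 (S.1.flow 𝒱 μ h (g ∘ₗ f)) := by
  refine ⟨by rw [CarpKernel.qKernel], fun n hn => ?_⟩
  let eqv : CarpKernel.carpTrees n ≃ CarpKernel.QTree n :=
    Equiv.subtypeEquivRight fun S => and_congr_right fun _ =>
      CarpKernel.DecTree.isCarp_iff_isKernelTree
  have hfin : Finite (CarpKernel.carpTrees n) := Finite.of_equiv _ eqv.symm
  refine ⟨hfin, CarpKernel.evalSeq_ext fun x => ?_⟩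
  have : Fintype (CarpKernel.carpTrees n) := Fintype.ofFinite _
  rw [finsum_eq_sum_of_fintype, CarpKernel.evalSeq_sum,
    CarpKernel.evalSeq_qKernel 𝒱 μ h (g ∘ₗ f) hh (fun i x hx => hg i _ (hf i x hx)) hμ n
      (by omega) x, ← eqv.sum_comp]
  refine Finset.sum_congr rfl fun S _ => ?_
  rw [CarpKernel.evalSeq_negOnePow_smul, CarpKernel.evalSeq_castOp]
  rfl
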